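/- Theorem 2. Let $F$ and $G$ be absolutely continuous distribution functions with densities $f$ and $g$ whose supports are $[a,b]$ and $[c,d]$, where $-\infty<a<b<\infty$, $-\infty<c<d<\infty$, $a<d$ and $c<b$. Assume that $f$ is bounded and bounded away from zero on $[a,b]$ and continuous on $(a,b)$, and that $g$ is bounded and bounded away from zero on $[c,d]$ and continuous on $(c,d)$. Fix $\epsilon>0$ and let $\mathscr A$ be the set of pairs $\alpha=(M,N)$ of positive integers such that $\lambda_\alpha:=M/N\in[\,1-F(d)+\epsilon,\ 1/(G(a)+\epsilon)\,]$. For $\alpha=(M,N)\in\mathscr A$ consider a market with $N$ buyers and $M$ sellers whose valuations $V_1,\dots,V_N\sim F$ and costs $C_1,\dots,C_M\sim G$ are all independent. Let $V_{[1]}\ge\dots\ge V_{[N]}$ and $C_{(1)}\le\dots\le C_{(M)}$ be the ordered valuations and costs, and let the efficient quantity be $$K_\alpha=\bigl|\{k\in\{1,\dots,N\wedge M\}: V_{[k]}-C_{(k)}\ge 0\}\bigr|.$$ Let $F^{(-1)}$ and $G^{(-1)}$ be the inverses of $F$ on $[a,b]$ and of $G$ on $[c,d]$, and put $$E_\alpha(t)=F^{(-1)}(1-t)-G^{(-1)}\bigl((\lambda_\alpha^{-1}t)\wedge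 1\bigr),\quad t\in[0,1],\qquad t_\alpha=\sup\{t\in(0,1):E_\alpha(t)\ge 0\},$$ $$\sigma_\alpha^2=\frac{1}{(E_\alpha'(t_\alpha))^2}\left[\frac{t_\alpha(1-t_\alpha)}{f^2(F^{(-1)}(1-t_\alpha))}+\frac{t_\alpha(1-\lambda_\alpha^{-1}t_\alpha)}{\lambda_\alpha^2\,g^2(G^{(-1)}(\lambda_\alpha^{-1}t_\alpha))}\right],$$ $$S_\alpha(t)=\frac{1-t}{f(F^{(-1)}(1-t))}\int_{F^{(-1)}(1-t)}^{b}(1-F(x))\,dx+\frac{1-\lambda_\alpha^{-1}t}{g(G^{(-1)}(\lambda_\alpha^{-1}t))}\int_c^{G^{(-1)}(\lambda_\alpha^{-1}t)}G(x)\,dx,$$ $$\varsigma_\alpha^2=2\int_0^{t_\alpha}S_\alpha(t)\,dt,\qquad \varkappa_\alpha=-\frac{S_\alpha(t_\alpha)}{E_\alpha'(t_\alpha)}.$$ Suppose that $F=G$. Then: (i) for all $\alpha\in\mathscr A$, $\displaystyle t_\alpha=\frac{\lambda_\alpha}{1+\lambda_\alpha}$ and $\displaystyle\sigma_\alpha^2=\frac{\lambda_\alpha^2}{(1+\lambda_\alpha)^3}$;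 (ii) for all $\alpha=(M,N)\in\mathscr A$, $K_\alpha$ has the hypergeometric distribution of the number of special elements in a sample of size $N$ drawn without replacement from a population of size $N+M$ with $M$ special elements; and there exist constants $C_1,C_2\in(0,\infty)$, not depending on $\alpha$, such that for all $\alpha=(M,N)\in\mathscr A$ $$\frac{C_1}{N^{1/2}}\le\sup_{x\in\mathbb R}\left|\mathbf P\left(\frac{K_\alpha-Nt_\alpha}{\sigma_\alpha N^{1/2}}\le x\right)-\Phi(x)\right|\le\frac{C_2}{N^{1/2}},$$ where $\Phi$ is the standard normal distribution function; (iii) if, moreover, $F(t)=G(t)=t$ for $t\in(0,1)$, then for all $\alpha\in\mathscr A$ $$\int_0^{t_\alpha}E_\alpha(t)\,dt=\frac{\lambda_\alpha}{2(1+\lambda_\alpha)},\qquad \varsigma_\alpha^2=\frac{\lambda_\alpha(1+3\lambda_\alpha+\lambda_\alpha^2)}{12(1+\lambda_\alpha)^3},\qquad \varkappa_\alpha=\frac{\lambda_\alpha^2}{2(1+\lambda_\alpha)^3}.$$ -/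

import Mathlib

open MeasureTheory ProbabilityTheory Set

noncomputable section

/-- The distributional data of a market with independent private values: the distribution function
`F` of the buyers' valuations, with density `f` and support `[a, b]`, and the distribution
function `G` of the sellers' costs, with density `g` and support `[c, d]`. -/
structure MarketModel where
  F : ℝ → ℝ
  f : ℝ → ℝ
  a : ℝ
  b : ℝ
  G : ℝ → ℝ
  g : ℝ → ℝ
  c : ℝ
  d : ℝ

/-- `H` is an absolutely continuous distribution function on the line with support `[l, r]` and
with density `h` that is bounded and bounded away from zero on `[l, r]`. -/
structure HasBoundedDensityOn (H h : ℝ → ℝ) (l r : ℝ) : Prop where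
  lt : l < r
  integrable : Integrable h
  integral_eq_one : ∫ x, h x = 1
  eq_integral : ∀ x, H x = ∫ s in Iic x, h s
  eq_zero : ∀ x, x ∉ Icc l r → h x = 0
  bounds : ∃ m B : ℝ, 0 < m ∧ ∀ x ∈ Icc l r, m ≤ h x ∧ h x ≤ B

/-- The inverse of the restriction of a distribution function `H` to its support `[l, r]`. -/
def quantile (H : ℝ → ℝ) (l r : ℝ) : ℝ → ℝ :=
  Function.invFunOn H (Icc l r)

/-- The extension `s ↦ h (s ∧ 1)` to `[0, ∞)` of a function `h` on `[0, 1]`. -/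
def capped (h : ℝ → ℝ) (s : ℝ) : ℝ := h (min s 1)

/-- The functional `h ↦ sup {t ∈ (0, 1) : h t ≥ 0}`. -/
def lastNonneg (h : ℝ → ℝ) : ℝ := sSup {t ∈ Ioo (0 : ℝ) 1 | 0 ≤ h t}

/-- The ratio of the number `M` of sellers to the number `N` of buyers. -/
def ratio (M N : ℕ) : ℝ := (M : ℝ) / (N : ℝ)

namespace MarketModel

/-- Both distribution functions are absolutely continuous, with densities bounded and bounded away
from zero on their supports, and the supports overlap. -/
structure Regular (m : MarketModel) : Prop where
  buyers : HasBoundedDensityOn m.F m.f m.a m.b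
  sellers : HasBoundedDensityOn m.G m.g m.c m.d
  a_lt_d : m.a < m.d
  c_lt_b : m.c < m.b

/-- The index set of the markets `α = (M, N)` under consideration. -/
def indexSet (m : MarketModel) (ε : ℝ) : Set (ℕ × ℕ) :=
  {α | 0 < α.1 ∧ 0 < α.2 ∧
    ratio α.1 α.2 ∈ Icc (1 - m.F m.d + ε) (1 / (m.G m.a + ε))}

/-- The inverse of `F`. -/
def Finv (m : MarketModel) : ℝ → ℝ := quantile m.F m.a m.b

/-- The inverse of `G`. -/
def Ginv (m : MarketModel) : ℝ → ℝ := quantile m.G m.c m.d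

/-- The function `E_α`; here and below `lam` is `λ_α`. -/
def E (m : MarketModel) (lam t : ℝ) : ℝ :=
  m.Finv (1 - t) - capped m.Ginv (lam⁻¹ * t)

/-- The point `t_α`. -/
def tStar (m : MarketModel) (lam : ℝ) : ℝ := lastNonneg (m.E lam)

/-- The variance `σ_α²`. -/
def sigmaSq (m : MarketModel) (lam : ℝ) : ℝ :=
  1 / (deriv (m.E lam) (m.tStar lam)) ^ 2 *
    (m.tStar lam * (1 - m.tStar lam) / (m.f (m.Finv (1 - m.tStar lam))) ^ 2 +
      m.tStar lam * (1 - lam⁻¹ * m.tStar lam) /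
        (lam ^ 2 * (m.g (m.Ginv (lam⁻¹ * m.tStar lam))) ^ 2))

/-- The function `S_α`. -/
def S (m : MarketModel) (lam t : ℝ) : ℝ :=
  (1 - t) / m.f (m.Finv (1 - t)) * (∫ x in (m.Finv (1 - t))..m.b, (1 - m.F x)) +
    (1 - lam⁻¹ * t) / m.g (m.Ginv (lam⁻¹ * t)) * (∫ x in m.c..(m.Ginv (lam⁻¹ * t)), m.G x)

/-- The variance `ς_α²`. -/
def varsigmaSq (m : MarketModel) (lam : ℝ) : ℝ :=
  2 * ∫ t in (0 : ℝ)..(m.tStar lam), m.S lam t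

/-- The covariance `κ_α`. -/
def kappa (m : MarketModel) (lam : ℝ) : ℝ :=
  -(m.S lam (m.tStar lam)) / deriv (m.E lam) (m.tStar lam)

/-- `V` and `C` form a realization, on the probability space `(Ω, P)`, of the market with `N`
buyers and `M` sellers: all valuations and costs are independent, the valuations have distribution
function `F` and the costs have distribution function `G`. -/
structure IsRealization (m : MarketModel) {Ω : Type*} [MeasurableSpace Ω] (P : Measure Ω)
    {M N : ℕ} (V : Fin N → Ω → ℝ) (C : Fin M → Ω → ℝ) : Prop where
  measurable_V : ∀ i, Measurable (V i)
  measurable_C : ∀ j, Measurable (C j)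
  indep : iIndepFun (fun i : Fin N ⊕ Fin M => Sum.elim V C i) P
  law_V : ∀ i x, P.real {ω | V i ω ≤ x} = m.F x
  law_C : ∀ j x, P.real {ω | C j ω ≤ x} = m.G x

end MarketModel

/-- The order statistics of a sample in increasing order (the smallest has index `0`). -/
def ascending {n : ℕ} (v : Fin n → ℝ) (i : Fin n) : ℝ := v (Tuple.sort v i)

/-- The order statistics of a sample in decreasing order (the largest has index `0`). -/
def descending {n : ℕ} (v : Fin n → ℝ) (i : Fin n) : ℝ := ascending v i.rev

/-- The efficient quantity: the number of `k ≤ N ∧ M` such that the `k`-th largest valuation is at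
least the `k`-th smallest cost. -/
def efficientQuantity {M N : ℕ} (v : Fin N → ℝ) (c : Fin M → ℝ) : ℕ :=
  Fintype.card {k : Fin (min N M) //
    0 ≤ descending v (k.castLE (min_le_left N M)) - ascending c (k.castLE (min_le_right N M))}

/-- The probability that a sample of size `n`, drawn without replacement from a population of size
`p` with `s` special elements, contains exactly `k` special elements. -/
def hypergeometricProb (n s p k : ℕ) : ℝ :=
  if k ≤ n then ((s.choose k : ℝ) * ((p - s).choose (n - k) : ℝ)) / (p.choose n : ℝ) else 0

/-- The Kolmogorov distance between the distribution of `X` under `P` and the standard normal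
distribution. -/
def kolmogorovDistNormal {Ω : Type*} [MeasurableSpace Ω] (P : Measure Ω) (X : Ω → ℝ) : ℝ :=
  ⨆ x : ℝ, |P.real {ω | X ω ≤ x} - cdf (gaussianReal 0 1) x|

end

open Filter Topology

/-! When `F = G`, the pooled `N + M` valuations and costs are i.i.d. without atoms, so almost surely
the `N` lowest form a uniformly random `N`-subset. The threshold above them clears the market: if
`k` costs lie below it, so do `N - k` valuations, which leaves `k` valuations above, and the
efficient quantity is `k` (`efficientQuantity_eq_card`). Counting subsets gives the hypergeometric
law.

The normal approximation is Stein's method. The ratio of consecutive atoms yields `E[(K - c) f(K)] =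
E[(M - K)(N - K)/(M + N) * (f(K + 1) - f(K))]` with `c = MN/(M + N)`
(`hyperMean_sub_hyperCenter_mul`). For `W = (K - c)/s` and the Stein solution `f` of the half-line
up to `z`, the error `E[f'(W) - W f(W)]` thus compares `f'` with a weighted difference quotient of
step `1/s`, which is `O(N ^ (-1/2))`. The weight differs from 1 only by the fluctuation of `K` about
`c`. The quotient is close to `f'` unless the step crosses the kink `z`, which happens for at most
one value of `K`; the same identity with a step function as `f` bounds the probability of that value
(`hypergeometricProb_le`).

For the lower bound, Chebyshev's inequality puts mass `3/4` on `O(√N)` integers, so some atom is at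
least a constant over `√N` (`exists_le_hypergeometricProb`), and no continuous function approximates
a jump better than half its size.

The closed formulas hold because the two quantile functions coincide: `E_α(t) ≥ 0` means `t/λ ≤ 1 -
t`, and at `t_α` both quantiles are taken at `1/(1 + λ)`, so that the density cancels from the
variance. -/

/-- The primitive `x ↦ ∫ s in Iic x, h s` of an integrable function. -/
theorem integral_Iic_sub_eq_intervalIntegral {h : ℝ → ℝ} (hi : Integrable h) (x y : ℝ) :
    (∫ s in Iic y, h s) - ∫ s in Iic x, h s = ∫ s in x..y, h s :=
  intervalIntegral.integral_Iic_sub_Iic hi.integrableOn hi.integrableOn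

theorem hasDerivAt_integral_Iic {h : ℝ → ℝ} (hi : Integrable h) {x : ℝ}
    (hc : ContinuousAt h x) : HasDerivAt (fun y => ∫ s in Iic y, h s) (h x) x := by
  have h1 : HasDerivAt (fun y => ∫ s in x..y, h s) (h x) x :=
    intervalIntegral.integral_hasDerivAt_right (hi.intervalIntegrable)
      hi.aestronglyMeasurable.stronglyMeasurableAtFilter hc
  have h2 : (fun y => ∫ s in Iic y, h s) = fun y => (∫ s in x..y, h s) + ∫ s in Iic x, h s := by
    funext y
    rw [← integral_Iic_sub_eq_intervalIntegral hi]
    ring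
  rw [h2]
  exact h1.add_const _

/-! ### The standard normal distribution function -/

/-- The standard normal density. -/
noncomputable def stdPDF (x : ℝ) : ℝ := gaussianPDFReal 0 1 x

/-- The standard normal distribution function. -/
noncomputable def stdCDF (x : ℝ) : ℝ := cdf (gaussianReal 0 1) x

theorem stdPDF_eq (x : ℝ) : stdPDF x = (√(2 * Real.pi))⁻¹ * Real.exp (-x ^ 2 / 2) := by
  simp [stdPDF, gaussianPDFReal]

theorem stdPDF_pos (x : ℝ) : 0 < stdPDF x := gaussianPDFReal_pos 0 1 x one_ne_zero

theorem stdPDF_neg (x : ℝ) : stdPDF (-x) = stdPDF x := by simp [stdPDF_eq]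

theorem integrable_stdPDF : Integrable stdPDF := integrable_gaussianPDFReal 0 1

theorem hasDerivAt_stdPDF (x : ℝ) : HasDerivAt stdPDF (-x * stdPDF x) x := by
  have h : stdPDF = fun x => (√(2 * Real.pi))⁻¹ * Real.exp (-x ^ 2 / 2) := funext stdPDF_eq
  have h1 : HasDerivAt (fun x : ℝ => -x ^ 2 / 2) (-x) x := by
    have := ((hasDerivAt_pow 2 x).neg).div_const 2
    refine this.congr_deriv ?_
    norm_num
    ring
  rw [h]
  refine ((h1.exp).const_mul _).congr_deriv ?_
  ring

theorem stdCDF_eq_integral (x : ℝ) : stdCDF x = ∫ s in Iic x, stdPDF s := by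
  rw [stdCDF, cdf_eq_real, measureReal_def, gaussianReal_apply_eq_integral 0 one_ne_zero,
    ENNReal.toReal_ofReal]
  · rfl
  · exact setIntegral_nonneg measurableSet_Iic fun y _ => gaussianPDFReal_nonneg 0 1 y

theorem one_sub_stdCDF (x : ℝ) : 1 - stdCDF x = ∫ s in Ioi x, stdPDF s := by
  have h := integral_add_compl (measurableSet_Iic (a := x)) integrable_stdPDF
  rw [compl_Iic, ← stdCDF_eq_integral] at h
  have h1 : ∫ s, stdPDF s = 1 := integral_gaussianPDFReal_eq_one 0 one_ne_zero
  linarith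

theorem stdCDF_neg (x : ℝ) : stdCDF (-x) = 1 - stdCDF x := by
  rw [one_sub_stdCDF, stdCDF_eq_integral, ← neg_neg x, ← integral_comp_neg_Iic]
  simp [stdPDF_neg]

theorem stdCDF_nonneg (x : ℝ) : 0 ≤ stdCDF x := cdf_nonneg _ x

theorem stdCDF_le_one (x : ℝ) : stdCDF x ≤ 1 := cdf_le_one _ x

theorem stdCDF_mono : Monotone stdCDF := monotone_cdf _

theorem hasDerivAt_stdCDF (x : ℝ) : HasDerivAt stdCDF (stdPDF x) x := by
  rw [funext stdCDF_eq_integral]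
  exact hasDerivAt_integral_Iic integrable_stdPDF (hasDerivAt_stdPDF x).continuousAt

theorem continuous_stdCDF : Continuous stdCDF :=
  continuous_iff_continuousAt.2 fun x => (hasDerivAt_stdCDF x).continuousAt

theorem tendsto_stdPDF_atTop : Tendsto stdPDF atTop (𝓝 0) := by
  rw [funext stdPDF_eq]
  have h : Tendsto (fun x : ℝ => -x ^ 2 / 2) atTop atBot := by
    have : Tendsto (fun x : ℝ => x ^ 2 / 2) atTop atTop :=
      (tendsto_pow_atTop two_ne_zero).atTop_div_const two_pos
    simp only [neg_div]
    exact tendsto_neg_atTop_atBot.comp this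
  simpa using (Real.tendsto_exp_atBot.comp h).const_mul (√(2 * Real.pi))⁻¹

/-- The Mills ratio bound. -/
theorem mul_one_sub_stdCDF_le {x : ℝ} (hx : 0 ≤ x) : x * (1 - stdCDF x) ≤ stdPDF x := by
  have hd : ∀ y ∈ Ici x, HasDerivAt (fun y => -stdPDF y) (y * stdPDF y) y := fun y _ =>
    ((hasDerivAt_stdPDF y).neg).congr_deriv (by ring)
  have hp : ∀ y ∈ Ioi x, 0 ≤ y * stdPDF y := fun y hy =>
    mul_nonneg (hx.trans (le_of_lt hy)) (stdPDF_pos y).le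
  have ht : Tendsto (fun y => -stdPDF y) atTop (𝓝 0) := by
    simpa using tendsto_stdPDF_atTop.neg
  have h1 := integral_Ioi_of_hasDerivAt_of_nonneg' hd hp ht
  have h2 := integrableOn_Ioi_deriv_of_nonneg' hd hp ht
  rw [one_sub_stdCDF, ← integral_const_mul]
  -- On the tail `x ≤ s`, and `s * stdPDF s` has the exact primitive `-stdPDF`.
  calc ∫ s in Ioi x, x * stdPDF s ≤ ∫ s in Ioi x, s * stdPDF s := by
        refine setIntegral_mono_on ((integrable_stdPDF.const_mul x).integrableOn) h2
          measurableSet_Ioi fun s hs => ?_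
        exact mul_le_mul_of_nonneg_right (le_of_lt hs) (stdPDF_pos s).le
    _ = stdPDF x := by rw [h1]; ring

/-- The claim is invariant under `x ↦ -x`; for `x ≥ 0` it is the Mills bound together with `Φ ≤ 1`.
-/
theorem abs_mul_stdCDF_mul_le (x : ℝ) : |x| * (stdCDF x * (1 - stdCDF x)) ≤ stdPDF x := by
  wlog hx : 0 ≤ x generalizing x
  · have := this (-x) (by linarith)
    rw [abs_neg, stdCDF_neg, stdPDF_neg] at this
    linarith
  rw [abs_of_nonneg hx]
  have h1 := mul_one_sub_stdCDF_le hx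
  have h2 := stdCDF_nonneg x
  have h3 := stdCDF_le_one x
  nlinarith [mul_nonneg hx (sub_nonneg.2 h3)]

/-- For `|x| ≥ 1` the preceding bound suffices. For `|x| ≤ 1` the left side is at most `1/4`, while
the density is at least `(1/2)/3`. -/
theorem stdCDF_mul_le (x : ℝ) : stdCDF x * (1 - stdCDF x) ≤ 2 * stdPDF x := by
  have h2 := stdCDF_nonneg x
  have h3 := stdCDF_le_one x
  rcases le_total 1 |x| with hx | hx
  · have h1 := abs_mul_stdCDF_mul_le x
    nlinarith [mul_nonneg h2 (sub_nonneg.2 h3), stdPDF_pos x]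
  · have h4 : (1 : ℝ) / 6 ≤ stdPDF x := by
      have hx2 : x ^ 2 ≤ 1 := by rw [← sq_abs]; nlinarith [abs_nonneg x]
      have h5 : (1 : ℝ) / 2 ≤ Real.exp (-x ^ 2 / 2) := by
        have := Real.add_one_le_exp (-x ^ 2 / 2)
        linarith
      have h6 : √(2 * Real.pi) ≤ 3 := by
        rw [Real.sqrt_le_left (by norm_num)]
        linarith [Real.pi_lt_four]
      have h7 : 0 < √(2 * Real.pi) := Real.sqrt_pos.2 (by positivity)
      rw [stdPDF_eq, inv_mul_eq_div, div_le_div_iff₀ (by norm_num) h7]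
      linarith
    nlinarith [sq_nonneg (stdCDF x - 1 / 2)]

/-! ### The Stein equation for a half-line -/

/-- The bounded solution of the Stein equation `f' w - w f w = 1_{w ≤ z} - Φ z`. -/
noncomputable def steinSol (z w : ℝ) : ℝ :=
  if w ≤ z then stdCDF w / stdPDF w * (1 - stdCDF z) else (1 - stdCDF w) / stdPDF w * stdCDF z

/-- The derivative of the solution of the Stein equation. -/
noncomputable def steinDeriv (z w : ℝ) : ℝ :=
  w * steinSol z w + (if w ≤ z then 1 else 0) - stdCDF z

theorem steinSol_nonneg (z w : ℝ) : 0 ≤ steinSol z w := by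
  have h1 := fun x => sub_nonneg.2 (stdCDF_le_one x)
  have h2 := stdCDF_nonneg
  have h3 := fun x => (stdPDF_pos x).le
  unfold steinSol
  split_ifs
  · exact mul_nonneg (div_nonneg (h2 _) (h3 _)) (h1 _)
  · exact mul_nonneg (div_nonneg (h1 _) (h3 _)) (h2 _)

/-- By monotonicity of `Φ`, on either branch the solution is largest when `z = w`; this removes `z`
from all later bounds. -/
theorem steinSol_le (z w : ℝ) : steinSol z w ≤ stdCDF w * (1 - stdCDF w) / stdPDF w := by
  have h1 := sub_nonneg.2 (stdCDF_le_one w)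
  have h2 := stdCDF_nonneg w
  have h3 := stdPDF_pos w
  unfold steinSol
  split_ifs with h
  · rw [div_mul_eq_mul_div]
    gcongr
    exact stdCDF_mono h
  · rw [div_mul_eq_mul_div, mul_comm]
    gcongr
    exact stdCDF_mono (le_of_not_ge h)

theorem steinSol_le_two (z w : ℝ) : steinSol z w ≤ 2 :=
  (steinSol_le z w).trans ((div_le_iff₀ (stdPDF_pos w)).2 (stdCDF_mul_le w))

theorem abs_mul_steinSol_le (z w : ℝ) : |w * steinSol z w| ≤ 1 := by
  rw [abs_mul, abs_of_nonneg (steinSol_nonneg z w)]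
  calc |w| * steinSol z w ≤ |w| * (stdCDF w * (1 - stdCDF w) / stdPDF w) :=
        mul_le_mul_of_nonneg_left (steinSol_le z w) (abs_nonneg w)
    _ ≤ 1 := by
        rw [← mul_div_assoc]
        exact (div_le_one (stdPDF_pos w)).2 (abs_mul_stdCDF_mul_le w)

theorem abs_steinDeriv_le (z w : ℝ) : |steinDeriv z w| ≤ 2 := by
  have h1 := abs_le.1 (abs_mul_steinSol_le z w)
  have h2 := stdCDF_nonneg z
  have h3 := stdCDF_le_one z
  unfold steinDeriv
  rw [abs_le]
  split_ifs <;> constructor <;> linarith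

theorem hasDerivAt_stdCDF_div_stdPDF (x : ℝ) :
    HasDerivAt (fun x => stdCDF x / stdPDF x) (x * (stdCDF x / stdPDF x) + 1) x := by
  have h := (stdPDF_pos x).ne'
  refine ((hasDerivAt_stdCDF x).div (hasDerivAt_stdPDF x) h).congr_deriv ?_
  field_simp
  ring

theorem hasDerivAt_one_sub_stdCDF_div_stdPDF (x : ℝ) :
    HasDerivAt (fun x => (1 - stdCDF x) / stdPDF x) (x * ((1 - stdCDF x) / stdPDF x) - 1) x := by
  have h := (stdPDF_pos x).ne'
  refine (((hasDerivAt_stdCDF x).const_sub 1).div (hasDerivAt_stdPDF x) h).congr_deriv ?_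
  field_simp
  ring

theorem steinSol_of_le {z w : ℝ} (h : w ≤ z) :
    steinSol z w = stdCDF w / stdPDF w * (1 - stdCDF z) := if_pos h

theorem steinSol_of_ge {z w : ℝ} (h : z ≤ w) :
    steinSol z w = (1 - stdCDF w) / stdPDF w * stdCDF z := by
  rcases h.eq_or_lt with rfl | h
  · rw [steinSol_of_le le_rfl]
    ring
  · exact if_neg h.not_ge

/-- The mean value theorem for the Stein solution to the left of the kink. -/
theorem exists_steinSol_sub_eq_of_le {z x y : ℝ} (hxy : x < y) (hy : y ≤ z) :
    ∃ ξ ∈ Ioo x y, steinSol z y - steinSol z x = steinDeriv z ξ * (y - x) := by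
  have hd : ∀ w, HasDerivAt (fun w => stdCDF w / stdPDF w * (1 - stdCDF z))
      ((w * (stdCDF w / stdPDF w) + 1) * (1 - stdCDF z)) w := fun w =>
    (hasDerivAt_stdCDF_div_stdPDF w).mul_const _
  obtain ⟨ξ, hξ, h⟩ := exists_hasDerivAt_eq_slope _ _ hxy
    (fun w _ => (hd w).continuousAt.continuousWithinAt) (fun w _ => hd w)
  refine ⟨ξ, hξ, ?_⟩
  rw [eq_div_iff (sub_pos.2 hxy).ne'] at h
  rw [steinSol_of_le hy, steinSol_of_le (hxy.le.trans hy), ← h, steinDeriv,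
    steinSol_of_le (hξ.2.le.trans hy), if_pos (hξ.2.le.trans hy)]
  ring

/-- The mean value theorem for the Stein solution to the right of the kink. -/
theorem exists_steinSol_sub_eq_of_ge {z x y : ℝ} (hxy : x < y) (hx : z ≤ x) :
    ∃ ξ ∈ Ioo x y, steinSol z y - steinSol z x = steinDeriv z ξ * (y - x) := by
  have hd : ∀ w, HasDerivAt (fun w => (1 - stdCDF w) / stdPDF w * stdCDF z)
      ((w * ((1 - stdCDF w) / stdPDF w) - 1) * stdCDF z) w := fun w =>
    (hasDerivAt_one_sub_stdCDF_div_stdPDF w).mul_const _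
  obtain ⟨ξ, hξ, h⟩ := exists_hasDerivAt_eq_slope _ _ hxy
    (fun w _ => (hd w).continuousAt.continuousWithinAt) (fun w _ => hd w)
  refine ⟨ξ, hξ, ?_⟩
  have hzξ : z < ξ := hx.trans_lt hξ.1
  rw [eq_div_iff (sub_pos.2 hxy).ne'] at h
  rw [steinSol_of_ge hx, steinSol_of_ge (hx.trans hxy.le), ← h, steinDeriv,
    steinSol_of_ge hzξ.le, if_neg hzξ.not_ge]
  ring

/-- The mean value theorem applies on each side of the kink; an interval containing `z` is split
there. -/
theorem abs_steinSol_sub_le {z x y : ℝ} (hxy : x ≤ y) :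
    |steinSol z y - steinSol z x| ≤ 2 * (y - x) := by
  have key : ∀ u v, u ≤ v → (v ≤ z ∨ z ≤ u) → |steinSol z v - steinSol z u| ≤ 2 * (v - u) := by
    intro u v huv h
    rcases huv.eq_or_lt with rfl | huv
    · simp
    obtain ⟨ξ, -, hξ⟩ : ∃ ξ ∈ Ioo u v, steinSol z v - steinSol z u = steinDeriv z ξ * (v - u) :=
      h.elim (exists_steinSol_sub_eq_of_le huv) (exists_steinSol_sub_eq_of_ge huv)
    rw [hξ, abs_mul, abs_of_pos (sub_pos.2 huv)]
    exact mul_le_mul_of_nonneg_right (abs_steinDeriv_le z ξ) (sub_pos.2 huv).le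
  rcases le_or_gt y z with hy | hy
  · exact key _ _ hxy (Or.inl hy)
  rcases le_or_gt z x with hx | hx
  · exact key _ _ hxy (Or.inr hx)
  have h1 := key x z hx.le (Or.inl le_rfl)
  have h2 := key z y hy.le (Or.inr le_rfl)
  have h3 := abs_sub_le (steinSol z y) (steinSol z z) (steinSol z x)
  linarith

theorem abs_mul_steinSol_sub_le {z x y : ℝ} (hxy : x ≤ y) :
    |y * steinSol z y - x * steinSol z x| ≤ (y - x) * (2 + 2 * |x|) := by
  have h : y * steinSol z y - x * steinSol z x =
      (y - x) * steinSol z y + x * (steinSol z y - steinSol z x) := by ring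
  rw [h]
  refine (abs_add_le _ _).trans ?_
  rw [abs_mul, abs_mul, abs_of_nonneg (sub_nonneg.2 hxy), abs_of_nonneg (steinSol_nonneg z y)]
  have h1 := mul_le_mul_of_nonneg_left (steinSol_le_two z y) (sub_nonneg.2 hxy)
  have h2 := mul_le_mul_of_nonneg_left (abs_steinSol_sub_le (z := z) hxy) (abs_nonneg x)
  linarith

/-- The difference quotients of the Stein solution approximate its derivative away from the
kink. -/
theorem abs_steinSol_slope_sub_steinDeriv_le {z w h : ℝ} (hh : 0 < h) :
    |(steinSol z (w + h) - steinSol z w) / h - steinDeriv z w| ≤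
      h * (2 + 2 * |w|) + 4 * (if w ≤ z ∧ z < w + h then 1 else 0) := by
  have hw : w < w + h := by linarith
  by_cases hc : w ≤ z ∧ z < w + h
  -- If the step crosses the kink, quotient and derivative are each at most 2 in absolute value,
  -- hence the constant 4.
  · rw [if_pos hc]
    have h1 := abs_steinSol_sub_le (z := z) hw.le
    have h2 := abs_steinDeriv_le z w
    have h3 : |(steinSol z (w + h) - steinSol z w) / h| ≤ 2 := by
      rw [abs_div, abs_of_pos hh, div_le_iff₀ hh]
      linarith
    have h4 := abs_sub ((steinSol z (w + h) - steinSol z w) / h) (steinDeriv z w)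
    have h5 : 0 ≤ h * (2 + 2 * |w|) := by positivity
    linarith
  -- Otherwise the intermediate point `ξ` lies on the same side of `z` as `w`, so the indicators in
  -- the Stein equation cancel and only the increment of `w * steinSol z w` remains.
  · rw [if_neg hc]
    obtain ⟨ξ, hξ, hs, hi⟩ : ∃ ξ ∈ Ioo w (w + h),
        steinSol z (w + h) - steinSol z w = steinDeriv z ξ * (w + h - w) ∧
          ((ξ ≤ z) ↔ (w ≤ z)) := by
      rcases lt_or_ge z w with hz | hz
      · obtain ⟨ξ, hξ, hs⟩ := exists_steinSol_sub_eq_of_ge hw hz.le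
        exact ⟨ξ, hξ, hs, ⟨fun h => by linarith [hξ.1], fun h => by linarith⟩⟩
      · have hz' : w + h ≤ z := by
          by_contra hcon
          exact hc ⟨hz, lt_of_not_ge hcon⟩
        obtain ⟨ξ, hξ, hs⟩ := exists_steinSol_sub_eq_of_le hw hz'
        exact ⟨ξ, hξ, hs, ⟨fun _ => hz, fun _ => by linarith [hξ.2]⟩⟩
    rw [hs, add_sub_cancel_left, mul_div_cancel_right₀ _ hh.ne']
    have h1 : steinDeriv z ξ - steinDeriv z w = ξ * steinSol z ξ - w * steinSol z w := by
      simp only [steinDeriv, hi]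
      ring
    rw [h1, mul_zero, add_zero]
    refine (abs_mul_steinSol_sub_le hξ.1.le).trans ?_
    have : ξ - w ≤ h := by linarith [hξ.2]
    gcongr

/-! ### The hypergeometric distribution of a sample of size `N` with `M` special elements out of
`N + M` -/

theorem hypergeometricProb_eq (M N k : ℕ) :
    hypergeometricProb N M (N + M) k =
      (M.choose k : ℝ) * (N.choose k : ℝ) / ((N + M).choose N : ℝ) := by
  unfold hypergeometricProb
  split_ifs with h
  · rw [Nat.add_sub_cancel, Nat.choose_symm h]
  · rw [Nat.choose_eq_zero_of_lt (lt_of_not_ge h)]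
    simp

theorem hypergeometricProb_nonneg (M N k : ℕ) : 0 ≤ hypergeometricProb N M (N + M) k := by
  rw [hypergeometricProb_eq]
  positivity

theorem hypergeometricProb_eq_zero_of_lt {M N k : ℕ} (h : M < k) :
    hypergeometricProb N M (N + M) k = 0 := by
  rw [hypergeometricProb_eq, Nat.choose_eq_zero_of_lt h]
  simp

theorem cast_succ_mul_choose_succ (n k : ℕ) :
    ((k : ℝ) + 1) * (n.choose (k + 1) : ℝ) = ((n : ℝ) - k) * (n.choose k : ℝ) := by
  rcases le_or_gt k n with h | h
  · have h1 := Nat.choose_succ_right_eq n k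
    rw [← Nat.cast_sub h]
    have h2 : ((n.choose (k + 1) * (k + 1) : ℕ) : ℝ) = ((n.choose k * (n - k) : ℕ) : ℝ) := by
      rw [h1]
    push_cast at h2
    rw [mul_comm, h2, mul_comm]
  · rw [Nat.choose_eq_zero_of_lt h, Nat.choose_eq_zero_of_lt (h.trans k.lt_succ_self)]
    simp

/-- Detailed balance for the hypergeometric distribution. -/
theorem hypergeometricProb_succ (M N k : ℕ) :
    ((k : ℝ) + 1) ^ 2 * hypergeometricProb N M (N + M) (k + 1) =
      ((M : ℝ) - k) * (N - k) * hypergeometricProb N M (N + M) k := by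
  rw [hypergeometricProb_eq, hypergeometricProb_eq]
  have h1 := cast_succ_mul_choose_succ M k
  have h2 := cast_succ_mul_choose_succ N k
  calc _ = (((k : ℝ) + 1) * (M.choose (k + 1) : ℝ)) * (((k : ℝ) + 1) * (N.choose (k + 1) : ℝ)) /
        ((N + M).choose N : ℝ) := by ring
    _ = _ := by rw [h1, h2]; ring

/-- The expectation of `g` under the hypergeometric distribution. -/
noncomputable def hyperMean (M N : ℕ) (g : ℕ → ℝ) : ℝ :=
  ∑ k ∈ Finset.range (N + 1), hypergeometricProb N M (N + M) k * g k

section hyperMean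

variable {M N : ℕ}

/-- Vandermonde's identity. -/
theorem hyperMean_one : hyperMean M N (fun _ => 1) = 1 := by
  have h : ∑ k ∈ Finset.range (N + 1), N.choose k * M.choose k = (N + M).choose N := by
    rw [Nat.add_comm N M, Nat.add_choose_eq, Finset.Nat.sum_antidiagonal_eq_sum_range_succ_mk]
    refine Finset.sum_congr rfl fun k hk => ?_
    rw [Nat.choose_symm (Nat.lt_succ_iff.1 (Finset.mem_range.1 hk)), mul_comm]
  have h0 : ((N + M).choose N : ℝ) ≠ 0 := by
    exact_mod_cast (Nat.choose_pos (Nat.le_add_right N M)).ne'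
  unfold hyperMean
  simp only [hypergeometricProb_eq, mul_one]
  rw [← Finset.sum_div, div_eq_one_iff_eq h0, ← h]
  push_cast
  exact Finset.sum_congr rfl fun k _ => mul_comm _ _

/-- The comparison is needed only on the support `k ≤ min M N`, where the factors `M - k` and `N -
k` are nonnegative. -/
theorem hyperMean_mono {g g' : ℕ → ℝ} (h : ∀ k, k ≤ M → k ≤ N → g k ≤ g' k) :
    hyperMean M N g ≤ hyperMean M N g' := by
  refine Finset.sum_le_sum fun k hk => ?_
  rcases le_or_gt k M with hM | hM
  · exact mul_le_mul_of_nonneg_left (h k hM (Nat.lt_succ_iff.1 (Finset.mem_range.1 hk)))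
      (hypergeometricProb_nonneg M N k)
  · simp [hypergeometricProb_eq_zero_of_lt hM]

theorem hyperMean_add (g g' : ℕ → ℝ) :
    hyperMean M N (fun k => g k + g' k) = hyperMean M N g + hyperMean M N g' := by
  simp only [hyperMean, mul_add, Finset.sum_add_distrib]

theorem hyperMean_const_mul (c : ℝ) (g : ℕ → ℝ) :
    hyperMean M N (fun k => c * g k) = c * hyperMean M N g := by
  simp only [hyperMean, Finset.mul_sum]
  exact Finset.sum_congr rfl fun k _ => by ring

theorem hyperMean_sub (g g' : ℕ → ℝ) :
    hyperMean M N (fun k => g k - g' k) = hyperMean M N g - hyperMean M N g' := by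
  simp only [hyperMean, mul_sub, Finset.sum_sub_distrib]

theorem hyperMean_const (c : ℝ) : hyperMean M N (fun _ => c) = c := by
  have := hyperMean_const_mul (M := M) (N := N) c fun _ => 1
  rw [hyperMean_one] at this
  simpa using this

theorem abs_hyperMean_le (g : ℕ → ℝ) : |hyperMean M N g| ≤ hyperMean M N fun k => |g k| := by
  refine (Finset.abs_sum_le_sum_abs _ _).trans (Finset.sum_le_sum fun k _ => ?_)
  rw [abs_mul, abs_of_nonneg (hypergeometricProb_nonneg M N k)]

/-- Detailed balance after an index shift; the boundary terms drop out because `k ^ 2` vanishes at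
`0` and `N - k` at `N`. -/
theorem hyperMean_sq_mul (f : ℕ → ℝ) :
    hyperMean M N (fun k => (k : ℝ) ^ 2 * f k) =
      hyperMean M N fun k => ((M : ℝ) - k) * (N - k) * f (k + 1) := by
  unfold hyperMean
  rw [Finset.sum_range_succ', Finset.sum_range_succ]
  simp only [Nat.cast_zero, sub_self, mul_zero, zero_mul, ne_eq, OfNat.ofNat_ne_zero,
    not_false_eq_true, zero_pow, add_zero]
  refine Finset.sum_congr rfl fun k _ => ?_
  have := hypergeometricProb_succ M N k
  push_cast
  linear_combination f (k + 1) * this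

/-- The Stein identity of the hypergeometric distribution. -/
theorem hyperMean_sub_mean_mul (f : ℕ → ℝ) :
    hyperMean M N (fun k => (((M : ℝ) + N) * k - M * N) * f k) =
      hyperMean M N fun k => ((M : ℝ) - k) * (N - k) * (f (k + 1) - f k) := by
  have h := hyperMean_sq_mul (M := M) (N := N) f
  -- The quadratic terms cancel: `k² - (M - k)(N - k) = (M + N) k - M N`.
  have h1 : (fun k : ℕ => (((M : ℝ) + N) * k - M * N) * f k) =
      fun k : ℕ => (k : ℝ) ^ 2 * f k - ((M : ℝ) - k) * (N - k) * f k := by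
    funext k; ring
  rw [h1, hyperMean_sub, h, ← hyperMean_sub]
  congr 1
  funext k
  ring

/-- The mean `M N / (M + N)` of the hypergeometric distribution. -/
noncomputable def hyperCenter (M N : ℕ) : ℝ := (M : ℝ) * N / (M + N)

theorem hyperMean_sub_hyperCenter_mul (hM : 0 < M) (f : ℕ → ℝ) :
    hyperMean M N (fun k => (k - hyperCenter M N) * f k) =
      hyperMean M N fun k => ((M : ℝ) - k) * (N - k) / (M + N) * (f (k + 1) - f k) := by
  have hpos : (0 : ℝ) < M + N := by positivity
  have h := hyperMean_sub_mean_mul (M := M) (N := N) f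
  have h1 : (fun k : ℕ => ((k : ℝ) - hyperCenter M N) * f k) =
      fun k : ℕ => ((M : ℝ) + N)⁻¹ * ((((M : ℝ) + N) * k - M * N) * f k) := by
    funext k; unfold hyperCenter; field_simp
  have h2 : (fun k : ℕ => ((M : ℝ) - k) * (N - k) / (M + N) * (f (k + 1) - f k)) =
      fun k : ℕ => ((M : ℝ) + N)⁻¹ * (((M : ℝ) - k) * (N - k) * (f (k + 1) - f k)) := by
    funext k; field_simp
  rw [h1, h2, hyperMean_const_mul, hyperMean_const_mul, h]

theorem hyperCenter_pos (hM : 0 < M) (hN : 0 < N) : 0 < hyperCenter M N := by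
  unfold hyperCenter; positivity

theorem hyperCenter_le (hM : 0 < M) : hyperCenter M N ≤ N := by
  unfold hyperCenter
  have hpos : (0 : ℝ) < M + N := by positivity
  rw [div_le_iff₀ hpos]
  have : (0 : ℝ) ≤ N := by positivity
  nlinarith

/-- The Stein identity with `f k = k - c` expresses the variance as the mean of `(M - k)(N - k)/(M +
N)`, which is at most `MN/(M + N) = c`. -/
theorem hyperMean_sq_sub_hyperCenter_le (hM : 0 < M) :
    hyperMean M N (fun k => (k - hyperCenter M N) ^ 2) ≤ hyperCenter M N := by
  have hpos : (0 : ℝ) < M + N := by positivity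
  have h := hyperMean_sub_hyperCenter_mul (N := N) hM fun k => k - hyperCenter M N
  simp only [← pow_two] at h
  rw [h, ← hyperMean_const (M := M) (N := N) (hyperCenter M N)]
  refine hyperMean_mono fun k hkM hkN => ?_
  rw [hyperMean_const]
  have h1 : (k : ℝ) ≤ M := by exact_mod_cast hkM
  have h2 : (k : ℝ) ≤ N := by exact_mod_cast hkN
  have h3 : (0 : ℝ) ≤ k := by positivity
  push_cast
  unfold hyperCenter
  rw [show ((k : ℝ) + 1 - M * N / (M + N) - (k - M * N / (M + N))) = 1 by ring, mul_one]
  gcongr <;> linarith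

/-- Cauchy–Schwarz in the pointwise form `x ≤ r/2 + x²/(2r)` with `r = √c`. -/
theorem hyperMean_abs_sub_hyperCenter_le (hM : 0 < M) (hN : 0 < N) :
    hyperMean M N (fun k => |(k : ℝ) - hyperCenter M N|) ≤ √(hyperCenter M N) := by
  have hc := hyperCenter_pos hM hN
  set r := √(hyperCenter M N) with hr
  have hr0 : 0 < r := Real.sqrt_pos.2 hc
  have hr2 : r ^ 2 = hyperCenter M N := Real.sq_sqrt hc.le
  have h1 : hyperMean M N (fun k => |(k : ℝ) - hyperCenter M N|) ≤
      hyperMean M N fun k => r / 2 + (2 * r)⁻¹ * ((k : ℝ) - hyperCenter M N) ^ 2 := by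
    refine hyperMean_mono fun k _ _ => ?_
    rw [← sq_abs]
    set x := |(k : ℝ) - hyperCenter M N|
    have : r / 2 + (2 * r)⁻¹ * x ^ 2 - x = (2 * r)⁻¹ * (r - x) ^ 2 := by
      field_simp
      ring
    have h2 : 0 ≤ (2 * r)⁻¹ * (r - x) ^ 2 := by positivity
    linarith
  refine h1.trans ?_
  rw [hyperMean_add, hyperMean_const, hyperMean_const_mul]
  have h2 := mul_le_mul_of_nonneg_left (hyperMean_sq_sub_hyperCenter_le (N := N) hM)
    (by positivity : 0 ≤ (2 * r)⁻¹)
  have h3 : (2 * r)⁻¹ * hyperCenter M N = r / 2 := by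
    rw [← hr2]
    field_simp
  linarith

theorem hyperMean_ite_eq_mul {j : ℕ} (hj : j ≤ N) (g : ℕ → ℝ) :
    hyperMean M N (fun k => g k * (if k = j then 1 else 0)) =
      g j * hypergeometricProb N M (N + M) j := by
  unfold hyperMean
  rw [Finset.sum_eq_single j]
  · simp [mul_comm]
  · intro k _ hk
    simp [hk]
  · intro h
    exact absurd (Finset.mem_range.2 (Nat.lt_succ_iff.2 hj)) h

/-- The Stein identity with `f k = 1_{j < k}`: its forward difference is the indicator of `k = j`,
so the right side isolates one atom, and the left side is at most `E|K - c|`. -/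
theorem mul_hypergeometricProb_le (hM : 0 < M) (hN : 0 < N) (j : ℕ) :
    ((M : ℝ) - j) * (N - j) * hypergeometricProb N M (N + M) j ≤
      (M + N) * √(hyperCenter M N) := by
  have hpos : (0 : ℝ) < M + N := by positivity
  rcases lt_or_ge N j with hj | hj
  · have : hypergeometricProb N M (N + M) j = 0 := if_neg hj.not_ge
    rw [this, mul_zero]
    positivity
  have h := hyperMean_sub_hyperCenter_mul (N := N) hM fun k => if j < k then 1 else 0
  have h1 : (fun k : ℕ => ((M : ℝ) - k) * (N - k) / (M + N) *
      ((if j < k + 1 then (1 : ℝ) else 0) - if j < k then 1 else 0)) =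
      fun k : ℕ => ((M : ℝ) - k) * (N - k) / (M + N) * (if k = j then 1 else 0) := by
    funext k
    congr 1
    split_ifs <;> first | omega | norm_num
  rw [h1, hyperMean_ite_eq_mul hj fun k : ℕ => ((M : ℝ) - k) * (N - k) / (M + N)] at h
  have h2 : hyperMean M N (fun k => (k - hyperCenter M N) * if j < k then 1 else 0) ≤
      √(hyperCenter M N) := by
    refine (hyperMean_mono fun k _ _ => ?_).trans (hyperMean_abs_sub_hyperCenter_le hM hN)
    split_ifs
    · rw [mul_one]; exact le_abs_self _
    · rw [mul_zero]; exact abs_nonneg _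
  rw [h, div_mul_eq_mul_div, div_le_iff₀ hpos] at h2
  linarith

/-- Detailed balance passes from the atom at `j` to the one at `j - 1`. This serves `j` above the
mean, where `(M - j)(N - j)` may degenerate. -/
theorem sq_mul_hypergeometricProb_le (hM : 0 < M) (hN : 0 < N) (j : ℕ) :
    (j : ℝ) ^ 2 * hypergeometricProb N M (N + M) j ≤ (M + N) * √(hyperCenter M N) := by
  cases j with
  | zero => simp; positivity
  | succ i =>
    push_cast
    rw [hypergeometricProb_succ]
    exact mul_hypergeometricProb_le hM hN i

theorem sub_hyperCenter_left (hM : 0 < M) : (M : ℝ) - hyperCenter M N = M ^ 2 / (M + N) := by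
  have hpos : (0 : ℝ) < M + N := by positivity
  unfold hyperCenter
  field_simp
  ring

theorem sub_hyperCenter_right (hM : 0 < M) : (N : ℝ) - hyperCenter M N = N ^ 2 / (M + N) := by
  have hpos : (0 : ℝ) < M + N := by positivity
  unfold hyperCenter
  field_simp
  ring

/-! ### Error bounds for balanced markets: `ε N ≤ M` and `ε M ≤ N` -/

section bounds

variable {ε : ℝ}

theorem add_le_of_balanced (hε : 0 < ε) (hε1 : ε ≤ 1) (h2 : ε * M ≤ N) :
    (M : ℝ) + N ≤ 2 * N / ε := by
  rw [le_div_iff₀ hε]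
  have : (0 : ℝ) ≤ N := by positivity
  nlinarith

theorem le_sub_hyperCenter_right (hε : 0 < ε) (hε1 : ε ≤ 1) (hM : 0 < M)
    (h2 : ε * M ≤ N) : ε * N / 2 ≤ (N : ℝ) - hyperCenter M N := by
  have hpos : (0 : ℝ) < M + N := by positivity
  rw [sub_hyperCenter_right hM, div_le_div_iff₀ two_pos hpos]
  have h3 : ε * (M + N) ≤ 2 * N := by
    have := add_le_of_balanced hε hε1 h2
    rw [le_div_iff₀ hε] at this
    linarith
  have : (0 : ℝ) ≤ N := by positivity
  nlinarith

theorem le_sub_hyperCenter_left (hε : 0 < ε) (hε1 : ε ≤ 1) (hM : 0 < M)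
    (h1 : ε * N ≤ M) : ε ^ 2 * N / 2 ≤ (M : ℝ) - hyperCenter M N := by
  have hpos : (0 : ℝ) < M + N := by positivity
  have hM' : (0 : ℝ) < M := by positivity
  rw [sub_hyperCenter_left hM, div_le_div_iff₀ two_pos hpos]
  have h3 : ε * (M + N) ≤ 2 * M := by nlinarith
  have h4 : ε * N * (ε * (M + N)) ≤ M * (2 * M) := by
    have : (0 : ℝ) ≤ N := by positivity
    gcongr
  nlinarith

theorem le_hyperCenter (hε1 : ε ≤ 1) (hM : 0 < M) (h1 : ε * N ≤ M) :
    ε * N / 2 ≤ hyperCenter M N := by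
  have hpos : (0 : ℝ) < M + N := by positivity
  have hM' : (0 : ℝ) < M := by positivity
  unfold hyperCenter
  rw [div_le_div_iff₀ two_pos hpos]
  have h3 : ε * (M + N) ≤ 2 * M := by nlinarith
  have : (0 : ℝ) ≤ N := by positivity
  nlinarith

/-- All atoms of the hypergeometric distribution are `O(N ^ (-1/2))`. -/
theorem hypergeometricProb_le (hε : 0 < ε) (hε1 : ε ≤ 1) (hM : 0 < M) (hN : 0 < N)
    (h1 : ε * N ≤ M) (h2 : ε * M ≤ N) (j : ℕ) :
    hypergeometricProb N M (N + M) j ≤ 8 / ε ^ 4 / √N := by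
  have hN' : (0 : ℝ) < N := by positivity
  have hp := hypergeometricProb_nonneg M N j
  have hr : √(hyperCenter M N) ≤ √N := Real.sqrt_le_sqrt (hyperCenter_le hM)
  have hr0 : 0 < √(N : ℝ) := Real.sqrt_pos.2 hN'
  have hr2 : √(N : ℝ) ^ 2 = N := Real.sq_sqrt hN'.le
  have ha := add_le_of_balanced hε hε1 h2
  have hu : ((M : ℝ) + N) * √(hyperCenter M N) ≤ 2 * N / ε * √N := by gcongr
  have hlow : ε ^ 3 * N ^ 2 / 4 * hypergeometricProb N M (N + M) j ≤ 2 * N / ε * √N := by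
    -- Below the mean `(M - j)(N - j)` is of order `N²`; above it, `j²` is.
    rcases le_total (j : ℝ) (hyperCenter M N) with hj | hj
    · refine le_trans ?_ ((mul_hypergeometricProb_le hM hN j).trans hu)
      refine mul_le_mul_of_nonneg_right ?_ hp
      have e1 := le_sub_hyperCenter_left hε hε1 hM h1
      have e2 := le_sub_hyperCenter_right hε hε1 hM h2
      calc ε ^ 3 * (N : ℝ) ^ 2 / 4 = (ε ^ 2 * N / 2) * (ε * N / 2) := by ring
        _ ≤ ((M : ℝ) - j) * (N - j) := by
          refine mul_le_mul (by linarith) (by linarith) (by positivity) ?_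
          have : 0 ≤ ε ^ 2 * N / 2 := by positivity
          linarith
    · refine le_trans ?_ ((sq_mul_hypergeometricProb_le hM hN j).trans hu)
      refine mul_le_mul_of_nonneg_right ?_ hp
      have e1 := (le_hyperCenter hε1 hM h1).trans hj
      calc ε ^ 3 * (N : ℝ) ^ 2 / 4 ≤ ε ^ 2 * (N : ℝ) ^ 2 / 4 := by
            have : ε ^ 3 ≤ ε ^ 2 := pow_le_pow_of_le_one hε.le hε1 (by norm_num)
            gcongr
        _ = (ε * N / 2) ^ 2 := by ring
        _ ≤ (j : ℝ) ^ 2 := by gcongr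
  rw [div_div, le_div_iff₀ (by positivity)]
  have hk : ε ^ 3 * N ^ 2 / 4 * hypergeometricProb N M (N + M) j * (4 * ε / (N * √N)) ≤
      2 * N / ε * √N * (4 * ε / (N * √N)) := mul_le_mul_of_nonneg_right hlow (by positivity)
  have e3 : 2 * N / ε * √N * (4 * ε / (N * √N)) = 8 := by field_simp; norm_num
  have e4 : ε ^ 3 * N ^ 2 / 4 * hypergeometricProb N M (N + M) j * (4 * ε / (N * √N)) =
      hypergeometricProb N M (N + M) j * (ε ^ 4 * √N) := by
    field_simp
    rw [hr2, mul_comm]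
  linarith

/-- With `A = M - c` and `B = N - c`, the deviation is exactly `-(1/A + 1/B)(x - c) + (x -
c)²/(AB)`, and `A`, `B` are at least of order `N`. -/
theorem abs_steinKernel_sub_one_le (hε : 0 < ε) (hε1 : ε ≤ 1) (hM : 0 < M) (hN : 0 < N)
    (h1 : ε * N ≤ M) (h2 : ε * M ≤ N) (x : ℝ) :
    |(M - x) * (N - x) / ((M - hyperCenter M N) * (N - hyperCenter M N)) - 1| ≤
      4 / (ε ^ 2 * N) * |x - hyperCenter M N| +
        4 / (ε ^ 3 * N ^ 2) * (x - hyperCenter M N) ^ 2 := by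
  have hN' : (0 : ℝ) < N := by positivity
  have e1 := le_sub_hyperCenter_left hε hε1 hM h1
  have e2 := le_sub_hyperCenter_right hε hε1 hM h2
  set c := hyperCenter M N
  set A := (M : ℝ) - c
  set B := (N : ℝ) - c
  have hA : 0 < A := lt_of_lt_of_le (by positivity) e1
  have hB : 0 < B := lt_of_lt_of_le (by positivity) e2
  have key : ((M : ℝ) - x) * (N - x) / (A * B) - 1 =
      -((A⁻¹ + B⁻¹) * (x - c)) + (A * B)⁻¹ * (x - c) ^ 2 := by
    rw [show (M : ℝ) - x = A - (x - c) by simp only [A]; ring,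
      show (N : ℝ) - x = B - (x - c) by simp only [B]; ring]
    field_simp
    ring
  rw [key]
  refine (abs_add_le _ _).trans ?_
  rw [abs_neg, abs_mul, abs_mul, abs_of_pos (by positivity : 0 < A⁻¹ + B⁻¹),
    abs_of_pos (by positivity : 0 < (A * B)⁻¹), abs_of_nonneg (sq_nonneg (x - c))]
  have i1 : A⁻¹ ≤ 2 / (ε ^ 2 * N) := by
    rw [inv_le_comm₀ hA (by positivity), inv_div]
    exact e1
  have i2 : B⁻¹ ≤ 2 / (ε * N) := by
    rw [inv_le_comm₀ hB (by positivity), inv_div]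
    exact e2
  have i3 : 2 / (ε * N) ≤ 2 / (ε ^ 2 * N) := by
    have : ε ^ 2 ≤ ε := by nlinarith
    gcongr
  have i4 : (A * B)⁻¹ ≤ 4 / (ε ^ 3 * N ^ 2) := by
    rw [mul_inv]
    calc A⁻¹ * B⁻¹ ≤ 2 / (ε ^ 2 * N) * (2 / (ε * N)) := by gcongr
      _ = 4 / (ε ^ 3 * N ^ 2) := by field_simp; norm_num
  have i5 : A⁻¹ + B⁻¹ ≤ 4 / (ε ^ 2 * N) := by
    calc A⁻¹ + B⁻¹ ≤ 2 / (ε ^ 2 * N) + 2 / (ε ^ 2 * N) := by linarith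
      _ = 4 / (ε ^ 2 * N) := by ring
  gcongr

/-- The Berry–Esseen bound for the hypergeometric distribution. -/
theorem abs_hyperMean_sub_stdCDF_le (hε : 0 < ε) (hε1 : ε ≤ 1) (hM : 0 < M) (hN : 0 < N)
    (h1 : ε * N ≤ M) (h2 : ε * M ≤ N) {s : ℝ} (hs : 0 < s)
    (hs2 : s ^ 2 = (M : ℝ) ^ 2 * N ^ 2 / (M + N) ^ 3) (z : ℝ) :
    |hyperMean M N (fun k => if (k - hyperCenter M N) / s ≤ z then 1 else 0) - stdCDF z| ≤
      100 / ε ^ 4 / √N := by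
  have hN' : (0 : ℝ) < N := by positivity
  have hM' : (0 : ℝ) < M := by positivity
  have hpos : (0 : ℝ) < M + N := by positivity
  have hr0 : 0 < √(N : ℝ) := Real.sqrt_pos.2 hN'
  have hr2 : √(N : ℝ) ^ 2 = N := Real.sq_sqrt hN'.le
  have e1 := le_sub_hyperCenter_left hε hε1 hM h1
  have e2 := le_sub_hyperCenter_right hε hε1 hM h2
  -- `s²` is the coefficient of the Stein identity at the mean, so the normalized weight `τ` below
  -- equals 1 there.
  have hAB : s ^ 2 = (M - hyperCenter M N) * (N - hyperCenter M N) / (M + N) := by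
    rw [hs2, sub_hyperCenter_left hM, sub_hyperCenter_right hM]
    field_simp
  have hA : 0 < (M : ℝ) - hyperCenter M N := lt_of_lt_of_le (by positivity) e1
  have hB : 0 < (N : ℝ) - hyperCenter M N := lt_of_lt_of_le (by positivity) e2
  have hslow : ε ^ 2 * √N / 3 ≤ s := by
    refine abs_le_of_sq_le_sq' ?_ hs.le |>.2
    rw [hAB, le_div_iff₀ hpos]
    calc (ε ^ 2 * √N / 3) ^ 2 * (M + N) = ε ^ 4 * N / 9 * (M + N) := by
          rw [div_pow, mul_pow, hr2]; ring
      _ ≤ ε ^ 4 * N / 8 * (2 * N / ε) := by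
          have := add_le_of_balanced hε hε1 h2
          gcongr
          norm_num
      _ = (ε ^ 2 * N / 2) * (ε * N / 2) := by field_simp; norm_num
      _ ≤ _ := by gcongr
  set c := hyperCenter M N with hc
  set h := s⁻¹ with hh
  have hh0 : 0 < h := inv_pos.2 hs
  have hhup : h ≤ 3 / (ε ^ 2 * √N) := by
    rw [hh, inv_le_comm₀ hs (by positivity), inv_div]
    exact hslow
  have hEabs : hyperMean M N (fun k => |(k : ℝ) - c|) ≤ √N :=
    (hyperMean_abs_sub_hyperCenter_le hM hN).trans (Real.sqrt_le_sqrt (hyperCenter_le hM))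
  have hEsq : hyperMean M N (fun k => ((k : ℝ) - c) ^ 2) ≤ N :=
    (hyperMean_sq_sub_hyperCenter_le hM).trans (hyperCenter_le hM)
  have hEabs0 : 0 ≤ hyperMean M N (fun k => |(k : ℝ) - c|) := (abs_nonneg _).trans (abs_hyperMean_le _)
  let w : ℕ → ℝ := fun k => (k - c) / s
  have hw : ∀ k, w (k + 1) = w k + h := fun k => by
    simp only [w, hh]; push_cast; field_simp; ring
  let q : ℕ → ℝ := fun k => (steinSol z (w k + h) - steinSol z (w k)) / h
  let τ : ℕ → ℝ := fun k => ((M : ℝ) - k) * (N - k) / ((M - c) * (N - c))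
  have hid : hyperMean M N (fun k => w k * steinSol z (w k)) = hyperMean M N fun k => τ k * q k := by
    have := hyperMean_sub_hyperCenter_mul (N := N) hM fun k => h * steinSol z (w k)
    convert this using 2
    · funext k
      simp only [w, hh]
      ring
    · funext k
      simp only [τ, q, hw, hh]
      have : (M - c) * (N - c) = s ^ 2 * (M + N) := by
        rw [hAB]; field_simp
      rw [this]
      field_simp
  -- The Stein equation is averaged and `W f(W)` is traded for `τ q`; what remains is the
  -- discretization error and the fluctuation of the weight.
  have hmain : hyperMean M N (fun k => if (k - c) / s ≤ z then 1 else 0) - stdCDF z =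
      hyperMean M N fun k => (steinDeriv z (w k) - q k) + (1 - τ k) * q k := by
    have : (fun k => (steinDeriv z (w k) - q k) + (1 - τ k) * q k) =
        fun k => ((if w k ≤ z then 1 else 0) - stdCDF z) + (w k * steinSol z (w k) - τ k * q k) := by
      funext k
      simp only [steinDeriv]
      ring
    rw [this, hyperMean_add, hyperMean_sub, hyperMean_sub, hid, hyperMean_const]
    ring
  rw [hmain]
  refine (abs_hyperMean_le _).trans ?_
  have hq : ∀ k, |q k| ≤ 2 := fun k => by
    simp only [q]
    rw [abs_div, abs_of_pos hh0, div_le_iff₀ hh0]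
    have := abs_steinSol_sub_le (z := z) (x := w k) (y := w k + h) (by linarith)
    linarith
  have hpt : hyperMean M N (fun k => |(steinDeriv z (w k) - q k) + (1 - τ k) * q k|) ≤
      hyperMean M N fun k => (2 * h + 2 * h ^ 2 * |(k : ℝ) - c|) +
        (4 * (if w k ≤ z ∧ z < w k + h then 1 else 0) +
        (8 / (ε ^ 2 * N) * |(k : ℝ) - c| + 8 / (ε ^ 3 * N ^ 2) * ((k : ℝ) - c) ^ 2)) := by
    refine hyperMean_mono fun k _ _ => ?_
    refine (abs_add_le _ _).trans ?_
    have b1 := abs_steinSol_slope_sub_steinDeriv_le (z := z) (w := w k) hh0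
    rw [abs_sub_comm] at b1
    have b2 := abs_steinKernel_sub_one_le hε hε1 hM hN h1 h2 (k : ℝ)
    rw [abs_sub_comm] at b2
    have b3 : |(1 - τ k) * q k| ≤ (4 / (ε ^ 2 * N) * |(k : ℝ) - c| +
        4 / (ε ^ 3 * N ^ 2) * ((k : ℝ) - c) ^ 2) * 2 := by
      rw [abs_mul]
      refine mul_le_mul b2 (hq k) (abs_nonneg _) ?_
      positivity
    have b4 : |w k| = h * |(k : ℝ) - c| := by
      simp only [w, hh]
      rw [abs_div, abs_of_pos hs]
      ring
    rw [b4] at b1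
    calc _ ≤ _ := add_le_add b1 b3
      _ = _ := by ring
  refine hpt.trans ?_
  rw [hyperMean_add, hyperMean_add, hyperMean_add, hyperMean_add, hyperMean_const,
    hyperMean_const_mul, hyperMean_const_mul, hyperMean_const_mul, hyperMean_const_mul]
  -- The points `w k` have spacing `h`, so at most one half-open interval `[w k, w k + h)` contains
  -- `z`; the mean is then a single atom or zero.
  have hatom : hyperMean M N (fun k => if w k ≤ z ∧ z < w k + h then 1 else 0) ≤
      8 / ε ^ 4 / √N := by
    by_cases hex : ∃ j, j ≤ N ∧ w j ≤ z ∧ z < w j + h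
    · obtain ⟨j, hjN, hj⟩ := hex
      have hmonow : ∀ a b : ℕ, a < b → w a + h ≤ w b := fun a b hab => by
        rw [← hw]
        simp only [w]
        gcongr
        exact_mod_cast hab
      have : hyperMean M N (fun k => if w k ≤ z ∧ z < w k + h then 1 else 0) =
          hyperMean M N (fun k => 1 * if k = j then 1 else 0) := by
        congr 1
        funext k
        rw [one_mul]
        rcases lt_trichotomy k j with hk | rfl | hk
        · have := hmonow _ _ hk
          rw [if_neg (fun hcon => by linarith [hcon.2, hj.1]), if_neg hk.ne]
        · rw [if_pos hj, if_pos rfl]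
        · have := hmonow _ _ hk
          rw [if_neg (fun hcon => by linarith [hcon.1, hj.2]), if_neg hk.ne']
      rw [this, hyperMean_ite_eq_mul hjN fun _ => (1 : ℝ), one_mul]
      exact hypergeometricProb_le hε hε1 hM hN h1 h2 j
    · have : hyperMean M N (fun k => if w k ≤ z ∧ z < w k + h then 1 else 0) ≤
          hyperMean M N fun _ => 0 := by
        refine hyperMean_mono fun k _ hk => ?_
        rw [if_neg fun hcon => hex ⟨k, hk, hcon⟩]
      rw [hyperMean_const] at this
      exact this.trans (by positivity)
  have c1 : 2 * h ≤ 6 / ε ^ 4 / √N := by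
    have : ε ^ 4 ≤ ε ^ 2 := pow_le_pow_of_le_one hε.le hε1 (by norm_num)
    calc 2 * h ≤ 2 * (3 / (ε ^ 2 * √N)) := by gcongr
      _ = 6 / ε ^ 2 / √N := by field_simp; norm_num
      _ ≤ _ := by gcongr
  have c2 : 2 * h ^ 2 * hyperMean M N (fun k => |(k : ℝ) - c|) ≤ 18 / ε ^ 4 / √N := by
    calc 2 * h ^ 2 * hyperMean M N (fun k => |(k : ℝ) - c|)
        ≤ 2 * (3 / (ε ^ 2 * √N)) ^ 2 * √N := by gcongr
      _ = 18 / ε ^ 4 / √N := by field_simp; norm_num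
  have c3 : 8 / (ε ^ 2 * N) * hyperMean M N (fun k => |(k : ℝ) - c|) ≤ 8 / ε ^ 4 / √N := by
    have : ε ^ 4 ≤ ε ^ 2 := pow_le_pow_of_le_one hε.le hε1 (by norm_num)
    calc 8 / (ε ^ 2 * N) * hyperMean M N (fun k => |(k : ℝ) - c|)
        ≤ 8 / (ε ^ 2 * N) * √N := by gcongr
      _ = 8 / ε ^ 2 / √N := by nth_rewrite 1 [← hr2]; field_simp
      _ ≤ _ := by gcongr
  have c4 : 8 / (ε ^ 3 * N ^ 2) * hyperMean M N (fun k => ((k : ℝ) - c) ^ 2) ≤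
      8 / ε ^ 4 / √N := by
    have i1 : ε ^ 4 ≤ ε ^ 3 := pow_le_pow_of_le_one hε.le hε1 (by norm_num)
    have i2 : √(N : ℝ) ≤ N := by
      have : (1 : ℝ) ≤ N := by exact_mod_cast hN
      rw [Real.sqrt_le_left hN'.le]
      nlinarith
    calc 8 / (ε ^ 3 * N ^ 2) * hyperMean M N (fun k => ((k : ℝ) - c) ^ 2)
        ≤ 8 / (ε ^ 3 * N ^ 2) * N := by gcongr
      _ = 8 / ε ^ 3 / N := by field_simp
      _ ≤ _ := by gcongr
  -- The constants add up to `6 + 18 + 32 + 8 + 8 = 72`.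
  calc _ ≤ (6 / ε ^ 4 / √N + 18 / ε ^ 4 / √N) +
        (4 * (8 / ε ^ 4 / √N) + (8 / ε ^ 4 / √N + 8 / ε ^ 4 / √(N : ℝ))) := by gcongr
    _ = 72 / ε ^ 4 / √N := by ring
    _ ≤ _ := by gcongr; norm_num

end bounds

/-- Some atom of the hypergeometric distribution is at least of order `N ^ (-1/2)`. -/
theorem exists_le_hypergeometricProb (hM : 0 < M) (hN : 0 < N) :
    ∃ k ≤ N, 3 / 20 / √N ≤ hypergeometricProb N M (N + M) k := by
  by_contra! hcon
  have hN' : (0 : ℝ) < N := by positivity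
  set r := √(N : ℝ) with hr
  have hr2 : r ^ 2 = N := Real.sq_sqrt hN'.le
  have hr1 : 1 ≤ r := Real.one_le_sqrt.2 (by exact_mod_cast hN)
  have hr0 : 0 < r := by linarith
  set c := hyperCenter M N with hc
  have hc0 : 0 < c := hyperCenter_pos hM hN
  have hEsq : hyperMean M N (fun k => ((k : ℝ) - c) ^ 2) ≤ N :=
    (hyperMean_sq_sub_hyperCenter_le hM).trans (hyperCenter_le hM)
  -- Chebyshev at radius `2√N`: the variance is at most `N`, so at most `1/4` of the mass lies
  -- outside.
  have hone : 1 ≤ hyperMean M N (fun k => if |(k : ℝ) - c| ≤ 2 * r then 1 else 0) + 1 / 4 := by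
    calc (1 : ℝ) = hyperMean M N (fun _ => 1) := hyperMean_one.symm
      _ ≤ hyperMean M N (fun k => (if |(k : ℝ) - c| ≤ 2 * r then 1 else 0) +
          (4 * N : ℝ)⁻¹ * ((k : ℝ) - c) ^ 2) := by
          refine hyperMean_mono fun k _ _ => ?_
          split_ifs with h
          · have : 0 ≤ (4 * N : ℝ)⁻¹ * ((k : ℝ) - c) ^ 2 := by positivity
            linarith
          · rw [zero_add, inv_mul_eq_div, le_div_iff₀ (by positivity), ← sq_abs, ← hr2]
            nlinarith
      _ ≤ _ := by
          rw [hyperMean_add, hyperMean_const_mul]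
          have : (4 * N : ℝ)⁻¹ * hyperMean M N (fun k => ((k : ℝ) - c) ^ 2) ≤
              (4 * N : ℝ)⁻¹ * N := by gcongr
          have h4 : (4 * N : ℝ)⁻¹ * N = 1 / 4 := by field_simp
          linarith
  let S := (Finset.range (N + 1)).filter fun k : ℕ => |(k : ℝ) - c| ≤ 2 * r
  have hS : hyperMean M N (fun k => if |(k : ℝ) - c| ≤ 2 * r then 1 else 0) =
      ∑ k ∈ S, hypergeometricProb N M (N + M) k := by
    simp only [hyperMean, S, Finset.sum_filter, mul_ite, mul_one, mul_zero]
  have hcard : (S.card : ℝ) ≤ 4 * r + 1 := by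
    rcases S.eq_empty_or_nonempty with he | hne
    · rw [he]; simp; positivity
    have hsub : S ⊆ Finset.Icc (S.min' hne) (S.max' hne) := fun k hk =>
      Finset.mem_Icc.2 ⟨S.min'_le k hk, S.le_max' k hk⟩
    have h1 := Finset.card_le_card hsub
    rw [Nat.card_Icc] at h1
    have hle : S.min' hne ≤ S.max' hne := S.min'_le_max' hne
    have h2 : (S.card : ℝ) ≤ (S.max' hne : ℝ) + 1 - S.min' hne := by
      have : S.card + S.min' hne ≤ S.max' hne + 1 := by omega
      have : ((S.card + S.min' hne : ℕ) : ℝ) ≤ ((S.max' hne + 1 : ℕ) : ℝ) := by exact_mod_cast this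
      push_cast at this
      linarith
    have h3 := abs_le.1 (Finset.mem_filter.1 (S.min'_mem hne)).2
    have h4 := abs_le.1 (Finset.mem_filter.1 (S.max'_mem hne)).2
    linarith [h3.1, h4.2]
  have hne : S.Nonempty := by
    by_contra he
    rw [Finset.not_nonempty_iff_eq_empty] at he
    rw [hS, he] at hone
    norm_num at hone
  -- At most `4r + 1 ≤ 5r` atoms, each below `3/(20r)`, carry less than `3/4`; nonemptiness of `S`
  -- makes this strict.
  have hlt : ∑ k ∈ S, hypergeometricProb N M (N + M) k < ∑ _k ∈ S, 3 / 20 / r :=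
    Finset.sum_lt_sum_of_nonempty hne fun k hk =>
      hcon k (Nat.lt_succ_iff.1 (Finset.mem_range.1 (Finset.mem_filter.1 hk).1))
  rw [Finset.sum_const, nsmul_eq_mul] at hlt
  have h5 : (S.card : ℝ) * (3 / 20 / r) ≤ 5 * r * (3 / 20 / r) := by
    gcongr
    linarith
  have h6 : 5 * r * (3 / 20 / r) = 3 / 4 := by field_simp; norm_num
  linarith

end hyperMean

/-! ### Order statistics and the efficient quantity -/

/-- Comparisons of order statistics with a threshold become counts, which sorting does not change.
-/
theorem ascending_le_iff {n : ℕ} (v : Fin n → ℝ) (θ : ℝ) (k : Fin n) :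
    ascending v k ≤ θ ↔ (k : ℕ) < (Finset.univ.filter fun i => v i ≤ θ).card := by
  have h := Tuple.lt_card_le_iff_apply_le_of_monotone (j := k) (a := θ) (Tuple.monotone_sort v)
  have hcard : (Finset.univ.filter fun i => (v ∘ Tuple.sort v) i ≤ θ).card =
      (Finset.univ.filter fun i => v i ≤ θ).card :=
    Finset.card_equiv (Tuple.sort v) fun i => by simp
  rw [hcard] at h
  exact h.symm

/-- The points of `ℝ ^ ι` whose coordinates in `A` are less than those outside of `A`. -/
def lowerCoords {ι : Type*} (A : Finset ι) : Set (ι → ℝ) :=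
  {x | ∀ i ∈ A, ∀ j ∉ A, x i < x j}

/-- If `A` are the `N` lowest ones among the valuations and costs, then the efficient quantity is
the number of costs in `A`. -/
theorem efficientQuantity_eq_card {M N : ℕ} (hN : 0 < N) {v : Fin N → ℝ} {c : Fin M → ℝ}
    {A : Finset (Fin N ⊕ Fin M)} (hA : A.card = N) (h : Sum.elim v c ∈ lowerCoords A) :
    efficientQuantity v c = A.toRight.card := by
  have hne : A.Nonempty := Finset.card_pos.1 (hA.symm ▸ hN)
  obtain ⟨i₀, hi₀, hmax⟩ := A.exists_max_image (Sum.elim v c) hne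
  -- `θ` is the largest pooled value in `A`, so `A` consists exactly of the agents with value at
  -- most `θ`.
  set θ := Sum.elim v c i₀
  have hθ : ∀ i, Sum.elim v c i ≤ θ ↔ i ∈ A := fun i =>
    ⟨fun hi => by_contra fun hcon => (h i₀ hi₀ i hcon).not_ge hi, fun hi => hmax i hi⟩
  have hv : (Finset.univ.filter fun i => v i ≤ θ) = A.toLeft := by
    ext i
    simp [← hθ]
  have hc : (Finset.univ.filter fun i => c i ≤ θ) = A.toRight := by
    ext i
    simp [← hθ]
  have hsum := Finset.card_toLeft_add_card_toRight (u := A)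
  have hM : A.toRight.card ≤ M := by simpa using A.toRight.card_le_univ
  -- With `κ` costs and `N - κ` valuations at most `θ`, the zero-based index `k` in decreasing order
  -- is `N - 1 - k` in increasing order. Hence cost `k` is at most `θ` iff `k < κ`, and valuation
  -- `k` exceeds `θ` iff `k < κ`.
  have key : ∀ k : Fin (min N M),
      0 ≤ descending v (k.castLE (min_le_left N M)) - ascending c (k.castLE (min_le_right N M)) ↔
        (k : ℕ) < A.toRight.card := by
    intro k
    have hk : (k : ℕ) < min N M := k.2
    have h1 := ascending_le_iff c θ (k.castLE (min_le_right N M))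
    have h2 := ascending_le_iff v θ (k.castLE (min_le_left N M)).rev
    rw [hc, Fin.val_castLE] at h1
    rw [hv, Fin.val_rev, Fin.val_castLE] at h2
    unfold descending
    rw [sub_nonneg]
    constructor
    · intro hle
      by_contra hcon
      exact hcon (h1.1 (hle.trans (h2.2 (by omega))))
    · intro hlt
      refine (h1.2 hlt).trans (le_of_not_ge fun hcon => ?_)
      have := h2.1 hcon
      omega
  unfold efficientQuantity
  rw [Fintype.card_subtype]
  simp only [key]
  rw [Fin.card_filter_val_lt]
  omega

/-! ### Exchangeability -/

/-- Equal cardinality gives `i ∈ A \ B` and `j ∈ B \ A`, and the two events order `x i` and `x j`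
oppositely. -/
theorem disjoint_lowerCoords {ι : Type*} {A B : Finset ι} (hcard : A.card = B.card) (hne : A ≠ B) :
    Disjoint (lowerCoords A) (lowerCoords B) := by
  have h1 : ¬ A ⊆ B := fun h => hne (Finset.eq_of_subset_of_card_le h hcard.ge)
  have h2 : ¬ B ⊆ A := fun h => hne (Finset.eq_of_subset_of_card_le h hcard.le).symm
  obtain ⟨i, hiA, hiB⟩ := Finset.not_subset.1 h1
  obtain ⟨j, hjB, hjA⟩ := Finset.not_subset.1 h2
  rw [Set.disjoint_left]
  intro x hxA hxB
  exact lt_asymm (hxA i hiA j hjA) (hxB j hjB i hiB)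

section lowerCoords

variable {ι : Type*} [Fintype ι]

theorem measurableSet_lowerCoords (A : Finset ι) : MeasurableSet (lowerCoords A) := by
  classical
  have : lowerCoords A = ⋂ i ∈ A, ⋂ j ∈ Aᶜ, {x : ι → ℝ | x i < x j} := by
    ext x
    simp [lowerCoords]
  rw [this]
  exact Finset.measurableSet_biInter _ fun i _ => Finset.measurableSet_biInter _ fun j _ =>
    measurableSet_lt (measurable_pi_apply i) (measurable_pi_apply j)

/-- Without ties the rank `r i`, the number of smaller coordinates, is a bijection onto `0, …, card
ι - 1`; the set wanted is `r i < n`. -/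
theorem exists_mem_lowerCoords {x : ι → ℝ} (hx : Function.Injective x) {n : ℕ}
    (hn : n ≤ Fintype.card ι) : ∃ A : Finset ι, A.card = n ∧ x ∈ lowerCoords A := by
  let r : ι → ℕ := fun i => (Finset.univ.filter fun j => x j < x i).card
  have hr : ∀ i j, x i < x j → r i < r j := fun i j hij => by
    refine Finset.card_lt_card (Finset.ssubset_iff_of_subset ?_ |>.2 ⟨i, ?_, ?_⟩)
    · intro k hk
      simp only [Finset.mem_filter, Finset.mem_univ, true_and] at hk ⊢
      exact hk.trans hij
    · simpa using hij
    · simp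
  have hinj : Function.Injective r := fun i j hij => by
    rcases lt_trichotomy (x i) (x j) with h | h | h
    · exact absurd hij (hr _ _ h).ne
    · exact hx h
    · exact absurd hij (hr _ _ h).ne'
  have hlt : ∀ i, r i < Fintype.card ι := fun i =>
    Finset.card_lt_univ_of_notMem (x := i) (by simp)
  have himg : Finset.univ.image r = Finset.range (Fintype.card ι) := by
    refine Finset.eq_of_subset_of_card_le ?_ ?_
    · intro k hk
      obtain ⟨i, -, rfl⟩ := Finset.mem_image.1 hk
      exact Finset.mem_range.2 (hlt i)
    · rw [Finset.card_image_of_injective _ hinj]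
      simp
  refine ⟨Finset.univ.filter fun i => r i < n, ?_, ?_⟩
  · rw [← Finset.card_image_of_injective _ hinj]
    have : (Finset.univ.filter fun i => r i < n).image r = Finset.range n := by
      ext k
      simp only [Finset.mem_image, Finset.mem_filter, Finset.mem_univ, true_and, Finset.mem_range]
      constructor
      · rintro ⟨i, hi, rfl⟩
        exact hi
      · intro hk
        have : k ∈ Finset.univ.image r := by
          rw [himg]
          exact Finset.mem_range.2 (hk.trans_le hn)
        obtain ⟨i, -, rfl⟩ := Finset.mem_image.1 this
        exact ⟨i, hk, rfl⟩
    rw [this, Finset.card_range]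
  · intro i hi j hj
    simp only [Finset.mem_filter, Finset.mem_univ, true_and, not_lt] at hi hj
    by_contra hcon
    rcases (not_lt.1 hcon).eq_or_lt with h | h
    · rw [hx h] at hj
      omega
    · have := hr _ _ h
      omega

variable {Ω : Type*} [MeasurableSpace Ω] {P : Measure Ω} [IsProbabilityMeasure P]
  {X : ι → Ω → ℝ} {ν : Measure ℝ}

/-- By Fubini, the diagonal is null for a product of laws without atoms. -/
theorem ae_injective_of_iIndepFun [NullSingletonClass ν] (hX : ∀ i, Measurable (X i))
    (hind : iIndepFun X P) (hlaw : ∀ i, P.map (X i) = ν) :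
    ∀ᵐ ω ∂P, Function.Injective fun i => X i ω := by
  have hne : ∀ i j, i ≠ j → ∀ᵐ ω ∂P, X i ω ≠ X j ω := by
    intro i j hij
    have hprob : IsProbabilityMeasure ν := hlaw i ▸ Measure.isProbabilityMeasure_map (hX i).aemeasurable
    have h1 := (indepFun_iff_map_prod_eq_prod_map_map (hX i).aemeasurable (hX j).aemeasurable).1
      (hind.indepFun hij)
    have hd : MeasurableSet {p : ℝ × ℝ | p.1 = p.2} :=
      measurableSet_eq_fun measurable_fst measurable_snd
    have h2 : P.map (fun ω => (X i ω, X j ω)) {p : ℝ × ℝ | p.1 = p.2} = 0 := by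
      rw [h1, hlaw, hlaw, Measure.measure_prod_null hd]
      refine Eventually.of_forall fun x => ?_
      have : Prod.mk x ⁻¹' {p : ℝ × ℝ | p.1 = p.2} = {x} := by
        ext y
        simp [eq_comm]
      change ν (Prod.mk x ⁻¹' {p : ℝ × ℝ | p.1 = p.2}) = 0
      rw [this]
      exact measure_singleton x
    rw [Measure.map_apply ((hX i).prodMk (hX j)) hd] at h2
    rw [ae_iff]
    simpa using h2
  have hall : ∀ᵐ ω ∂P, ∀ i j, i ≠ j → X i ω ≠ X j ω := by
    rw [ae_all_iff]
    intro i
    rw [ae_all_iff]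
    intro j
    by_cases hij : i = j
    · exact Eventually.of_forall fun _ h => absurd hij h
    · filter_upwards [hne i j hij] with ω hω _ using hω
  filter_upwards [hall] with ω hω i j hij
  by_contra hcon
  exact hω i j hcon hij

theorem map_comp_perm_eq (hX : ∀ i, Measurable (X i)) (hind : iIndepFun X P)
    (hlaw : ∀ i, P.map (X i) = ν) (σ : Equiv.Perm ι) :
    P.map (fun ω i => X (σ i) ω) = P.map fun ω i => X i ω := by
  have h1 := (iIndepFun_iff_map_fun_eq_pi_map fun i => (hX i).aemeasurable).1 hind
  have h2 := (iIndepFun_iff_map_fun_eq_pi_map fun i => (hX (σ i)).aemeasurable).1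
    (hind.precomp σ.injective)
  rw [h1, h2]
  simp only [hlaw]

/-- A permutation carrying `A` to `B` preserves the i.i.d. joint law and turns one event into the
other. -/
theorem measureReal_lowerCoords_eq_of_card_eq (hX : ∀ i, Measurable (X i)) (hind : iIndepFun X P)
    (hlaw : ∀ i, P.map (X i) = ν) {A B : Finset ι} (hcard : A.card = B.card) :
    P.real {ω | (fun i => X i ω) ∈ lowerCoords A} =
      P.real {ω | (fun i => X i ω) ∈ lowerCoords B} := by
  classical
  let σ : Equiv.Perm ι := (Finset.equivOfCardEq hcard).extendSubtype
  have hσ : ∀ i, σ i ∈ B ↔ i ∈ A := fun i =>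
    ⟨fun h => by_contra fun hi => (Finset.equivOfCardEq hcard).extendSubtype_not_mem i hi h,
      fun h => (Finset.equivOfCardEq hcard).extendSubtype_mem i h⟩
  have hset : ∀ x : ι → ℝ, (fun i => x (σ i)) ∈ lowerCoords A ↔ x ∈ lowerCoords B := by
    intro x
    constructor
    · intro h i hi j hj
      have := h (σ.symm i) ((hσ _).1 (by simpa using hi)) (σ.symm j)
        (fun hcon => hj (by simpa using (hσ _).2 hcon))
      simpa using this
    · intro h i hi j hj
      exact h _ ((hσ i).2 hi) _ fun hcon => hj ((hσ j).1 hcon)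
  have h1 := map_comp_perm_eq hX hind hlaw σ
  have h2 := congrArg (fun m => m (lowerCoords A)) h1
  rw [Measure.map_apply (measurable_pi_lambda _ fun i => hX (σ i)) (measurableSet_lowerCoords A),
    Measure.map_apply (measurable_pi_lambda _ hX) (measurableSet_lowerCoords A)] at h2
  have h3 : (fun ω i => X (σ i) ω) ⁻¹' lowerCoords A =
      {ω | (fun i => X i ω) ∈ lowerCoords B} := by
    ext ω
    exact hset fun i => X i ω
  rw [h3] at h2
  exact (congrArg ENNReal.toReal h2).symm

variable [NullSingletonClass ν]

/-- The probability of a union of events `lowerCoords A`. -/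
theorem measureReal_eq_sum_lowerCoords (hX : ∀ i, Measurable (X i)) (hind : iIndepFun X P)
    (hlaw : ∀ i, P.map (X i) = ν) {n : ℕ} (hn : n ≤ Fintype.card ι) {Q : Ω → Prop}
    {R : Finset ι → Prop} [DecidablePred R]
    (hQ : ∀ A : Finset ι, A.card = n → ∀ ω, (fun i => X i ω) ∈ lowerCoords A → (Q ω ↔ R A)) :
    P.real {ω | Q ω} = ∑ A ∈ (Finset.powersetCard n Finset.univ).filter R,
      P.real {ω | (fun i => X i ω) ∈ lowerCoords A} := by
  have hXm : Measurable fun ω i => X i ω := measurable_pi_lambda _ hX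
  rw [← measureReal_biUnion_finset]
  · refine measureReal_congr ?_
    filter_upwards [ae_injective_of_iIndepFun hX hind hlaw] with ω hω
    refine propext ?_
    change Q ω ↔ ω ∈ ⋃ A ∈ (Finset.powersetCard n Finset.univ).filter R,
      {ω | (fun i => X i ω) ∈ lowerCoords A}
    simp only [Set.mem_iUnion, Finset.mem_filter, Finset.mem_powersetCard, Finset.subset_univ,
      true_and, exists_prop, Set.mem_ofPred_eq]
    obtain ⟨A, hA, hωA⟩ := exists_mem_lowerCoords hω hn
    constructor
    · intro h
      exact ⟨A, ⟨hA, (hQ A hA ω hωA).1 h⟩, hωA⟩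
    · rintro ⟨B, ⟨hB, hRB⟩, hωB⟩
      exact (hQ B hB ω hωB).2 hRB
  · intro A hA B hB hne
    have hA' := (Finset.mem_powersetCard.1 (Finset.mem_filter.1 (Finset.mem_coe.1 hA)).1).2
    have hB' := (Finset.mem_powersetCard.1 (Finset.mem_filter.1 (Finset.mem_coe.1 hB)).1).2
    exact (disjoint_lowerCoords (hA'.trans hB'.symm) hne).preimage fun ω i => X i ω
  · intro A _
    exact hXm (measurableSet_lowerCoords A)

/-- Applied to the sure event, the decomposition splits total mass 1 into equally likely parts, one
for each subset of size `A.card`. -/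
theorem measureReal_lowerCoords (hX : ∀ i, Measurable (X i)) (hind : iIndepFun X P)
    (hlaw : ∀ i, P.map (X i) = ν) (A : Finset ι) :
    P.real {ω | (fun i => X i ω) ∈ lowerCoords A} =
      ((Fintype.card ι).choose A.card : ℝ)⁻¹ := by
  have h := measureReal_eq_sum_lowerCoords hX hind hlaw (n := A.card) A.card_le_univ
    (Q := fun _ => True) (R := fun _ => True) fun _ _ _ _ => Iff.rfl
  rw [Finset.sum_congr rfl fun B hB => measureReal_lowerCoords_eq_of_card_eq hX hind hlaw
    (Finset.mem_powersetCard.1 (Finset.mem_filter.1 hB).1).2] at h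
  simp only [Set.ofPred_true, probReal_univ, Finset.filter_true, Finset.sum_const,
    Finset.card_powersetCard, Finset.card_univ, nsmul_eq_mul] at h
  exact eq_inv_of_mul_eq_one_right h.symm

end lowerCoords

/-- Such a set is a free choice of `k` sellers and `N - k` buyers. -/
theorem card_filter_card_toRight_eq {M N k : ℕ} (hk : k ≤ N) :
    ((Finset.powersetCard N (Finset.univ : Finset (Fin N ⊕ Fin M))).filter
      fun A => A.toRight.card = k).card = M.choose k * N.choose k := by
  have h : ((Finset.powersetCard N (Finset.univ : Finset (Fin N ⊕ Fin M))).filter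
      fun A => A.toRight.card = k).card =
      ((Finset.powersetCard k (Finset.univ : Finset (Fin M))) ×ˢ
        (Finset.powersetCard (N - k) (Finset.univ : Finset (Fin N)))).card := by
    refine Finset.card_bij (fun A _ => (A.toRight, A.toLeft)) ?_ ?_ ?_
    · intro A hA
      have := Finset.card_toLeft_add_card_toRight (u := A)
      simp only [Finset.mem_filter, Finset.mem_powersetCard, Finset.subset_univ, true_and,
        Finset.mem_product] at hA ⊢
      omega
    · intro A _ B _ hAB
      rw [Prod.mk.injEq] at hAB
      rw [← Finset.toLeft_disjSum_toRight (u := A), ← Finset.toLeft_disjSum_toRight (u := B),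
        hAB.1, hAB.2]
    · rintro ⟨S, T⟩ hST
      simp only [Finset.mem_powersetCard, Finset.subset_univ, true_and, Finset.mem_product] at hST
      refine ⟨T.disjSum S, ?_, by simp⟩
      simp only [Finset.mem_filter, Finset.mem_powersetCard, Finset.subset_univ, true_and,
        Finset.card_disjSum, Finset.toRight_disjSum]
      omega
  rw [h, Finset.card_product, Finset.card_powersetCard, Finset.card_powersetCard,
    Finset.card_univ, Finset.card_univ, Fintype.card_fin, Fintype.card_fin, Nat.choose_symm hk]

/-- If the valuations and the costs are independent and have the same continuous distribution, then
the efficient quantity has a hypergeometric distribution. -/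
theorem measureReal_efficientQuantity_eq_hyperMean {M N : ℕ} (hN : 0 < N) {Ω : Type*}
    [MeasurableSpace Ω] {P : Measure Ω} [IsProbabilityMeasure P] {V : Fin N → Ω → ℝ}
    {C : Fin M → Ω → ℝ} {ν : Measure ℝ} [NullSingletonClass ν]
    (hX : ∀ i, Measurable (Sum.elim V C i)) (hind : iIndepFun (fun i => Sum.elim V C i) P)
    (hlaw : ∀ i, P.map (Sum.elim V C i) = ν) (Q : ℕ → Prop) [DecidablePred Q] :
    P.real {ω | Q (efficientQuantity (fun i => V i ω) (fun j => C j ω))} =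
      hyperMean M N fun k => if Q k then 1 else 0 := by
  have hcard : Fintype.card (Fin N ⊕ Fin M) = N + M := by simp
  have h := measureReal_eq_sum_lowerCoords hX hind hlaw (n := N) (by rw [hcard]; omega)
    (Q := fun ω => Q (efficientQuantity (fun i => V i ω) (fun j => C j ω)))
    (R := fun A => Q A.toRight.card) fun A hA ω hω => by
      have hω' : Sum.elim (fun i => V i ω) (fun j => C j ω) ∈ lowerCoords A := by
        convert hω using 1
        funext i
        cases i <;> rfl
      rw [efficientQuantity_eq_card hN hA hω']
  rw [h, Finset.sum_congr rfl fun A hA => by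
    rw [measureReal_lowerCoords hX hind hlaw A, hcard,
      (Finset.mem_powersetCard.1 (Finset.mem_filter.1 hA).1).2]]
  unfold hyperMean
  rw [Finset.sum_filter,
    ← Finset.sum_fiberwise_of_maps_to (t := Finset.range (N + 1)) (g := fun A => A.toRight.card)]
  · refine Finset.sum_congr rfl fun k hk => ?_
    rw [Finset.sum_congr rfl fun A hA => by rw [(Finset.mem_filter.1 hA).2], Finset.sum_const,
      card_filter_card_toRight_eq (Nat.lt_succ_iff.1 (Finset.mem_range.1 hk)), nsmul_eq_mul,
      hypergeometricProb_eq]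
    by_cases hQ : Q k <;> simp [hQ, div_eq_mul_inv]
  · intro A hA
    have := Finset.card_toRight_le (u := A)
    rw [(Finset.mem_powersetCard.1 hA).2] at this
    exact Finset.mem_range.2 (Nat.lt_succ_iff.2 this)

/-! ### Distribution functions with density bounded away from zero, and their quantiles -/

namespace HasBoundedDensityOn

variable {H h : ℝ → ℝ} {l r : ℝ}

theorem apply_sub_apply (hH : HasBoundedDensityOn H h l r) (x y : ℝ) :
    H y - H x = ∫ s in x..y, h s := by
  rw [hH.eq_integral, hH.eq_integral, integral_Iic_sub_eq_intervalIntegral hH.integrable]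

theorem hasDerivAt (hH : HasBoundedDensityOn H h l r) {x : ℝ} (hc : ContinuousAt h x) :
    HasDerivAt H (h x) x := by
  rw [funext hH.eq_integral]
  exact hasDerivAt_integral_Iic hH.integrable hc

theorem continuous (hH : HasBoundedDensityOn H h l r) : Continuous H := by
  have h1 : H = fun x => (∫ s in (0 : ℝ)..x, h s) + H 0 := by
    funext x
    rw [← hH.apply_sub_apply]
    ring
  rw [h1]
  exact (intervalIntegral.continuous_primitive
    (fun a b => hH.integrable.intervalIntegrable) 0).add continuous_const

theorem eq_zero_of_le (hH : HasBoundedDensityOn H h l r) {x : ℝ} (hx : x ≤ l) : H x = 0 := by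
  rw [hH.eq_integral, integral_Iic_eq_integral_Iio]
  exact setIntegral_eq_zero_of_forall_eq_zero fun y hy =>
    hH.eq_zero y fun hcon => (hcon.1.trans_lt hy).not_ge hx

theorem eq_one_of_ge (hH : HasBoundedDensityOn H h l r) {x : ℝ} (hx : r ≤ x) : H x = 1 := by
  have h1 := integral_add_compl (measurableSet_Iic (a := x)) hH.integrable
  have h2 : ∫ y in Ioi x, h y = 0 := setIntegral_eq_zero_of_forall_eq_zero fun y hy =>
    hH.eq_zero y fun hcon => (hx.trans_lt hy).not_ge hcon.2
  rwa [compl_Iic, hH.integral_eq_one, ← hH.eq_integral, h2, add_zero] at h1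

theorem exists_mul_sub_le (hH : HasBoundedDensityOn H h l r) :
    ∃ m : ℝ, 0 < m ∧ ∀ x ∈ Icc l r, ∀ y ∈ Icc l r, x ≤ y → m * (y - x) ≤ H y - H x := by
  obtain ⟨m, B, hm, hb⟩ := hH.bounds
  refine ⟨m, hm, fun x hx y hy hxy => ?_⟩
  rw [hH.apply_sub_apply]
  calc m * (y - x) = ∫ _s in x..y, m := by simp [mul_comm]
    _ ≤ _ := intervalIntegral.integral_mono_on hxy (by simp) hH.integrable.intervalIntegrable
        fun s hs => (hb s ⟨hx.1.trans hs.1, hs.2.trans hy.2⟩).1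

theorem pos_of_mem (hH : HasBoundedDensityOn H h l r) {x : ℝ} (hx : x ∈ Icc l r) : 0 < h x := by
  obtain ⟨m, B, hm, hb⟩ := hH.bounds
  exact hm.trans_le (hb x hx).1

theorem strictMonoOn (hH : HasBoundedDensityOn H h l r) : StrictMonoOn H (Icc l r) := by
  obtain ⟨m, hm, hb⟩ := hH.exists_mul_sub_le
  intro x hx y hy hxy
  have h1 := hb x hx y hy hxy.le
  have h2 := mul_pos hm (sub_pos.2 hxy)
  linarith

theorem surjOn (hH : HasBoundedDensityOn H h l r) : SurjOn H (Icc l r) (Icc 0 1) := by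
  have := intermediate_value_Icc hH.lt.le hH.continuous.continuousOn
  rwa [hH.eq_zero_of_le le_rfl, hH.eq_one_of_ge le_rfl] at this

theorem apply_pos (hH : HasBoundedDensityOn H h l r) {x : ℝ} (hx : l < x) : 0 < H x := by
  rcases le_or_gt x r with hr | hr
  · rw [← hH.eq_zero_of_le le_rfl]
    exact hH.strictMonoOn ⟨le_rfl, hH.lt.le⟩ ⟨hx.le, hr⟩ hx
  · rw [hH.eq_one_of_ge hr.le]
    exact one_pos

theorem apply_lt_one (hH : HasBoundedDensityOn H h l r) {x : ℝ} (hx : x < r) : H x < 1 := by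
  rcases le_or_gt l x with hl | hl
  · rw [← hH.eq_one_of_ge le_rfl]
    exact hH.strictMonoOn ⟨hl, hx.le⟩ ⟨hH.lt.le, le_rfl⟩ hx
  · rw [hH.eq_zero_of_le hl.le]
    exact one_pos

/-- The support is determined by the distribution function. -/
theorem support_unique {h' : ℝ → ℝ} {l' r' : ℝ} (hH : HasBoundedDensityOn H h l r)
    (hH' : HasBoundedDensityOn H h' l' r') : l = l' ∧ r = r' := by
  constructor
  · refine le_antisymm (le_of_not_gt fun hlt => ?_) (le_of_not_gt fun hlt => ?_)
    · exact (hH'.apply_pos hlt).ne' (hH.eq_zero_of_le le_rfl)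
    · exact (hH.apply_pos hlt).ne' (hH'.eq_zero_of_le le_rfl)
  · refine le_antisymm (le_of_not_gt fun hlt => ?_) (le_of_not_gt fun hlt => ?_)
    · exact (hH.apply_lt_one hlt).ne (hH'.eq_one_of_ge le_rfl)
    · exact (hH'.apply_lt_one hlt).ne (hH.eq_one_of_ge le_rfl)

theorem quantile_mem (hH : HasBoundedDensityOn H h l r) {y : ℝ} (hy : y ∈ Icc (0 : ℝ) 1) :
    quantile H l r y ∈ Icc l r :=
  Function.invFunOn_mem (hH.surjOn hy)

theorem apply_quantile (hH : HasBoundedDensityOn H h l r) {y : ℝ} (hy : y ∈ Icc (0 : ℝ) 1) :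
    H (quantile H l r y) = y :=
  Function.invFunOn_eq (hH.surjOn hy)

theorem quantile_eq (hH : HasBoundedDensityOn H h l r) {x y : ℝ} (hx : x ∈ Icc l r)
    (hxy : H x = y) : quantile H l r y = x := by
  rw [← hxy]
  exact hH.strictMonoOn.injOn.leftInvOn_invFunOn hx

theorem quantile_le_quantile_iff (hH : HasBoundedDensityOn H h l r) {x y : ℝ}
    (hx : x ∈ Icc (0 : ℝ) 1) (hy : y ∈ Icc (0 : ℝ) 1) :
    quantile H l r x ≤ quantile H l r y ↔ x ≤ y := by
  rw [← hH.strictMonoOn.le_iff_le (hH.quantile_mem hx) (hH.quantile_mem hy),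
    hH.apply_quantile hx, hH.apply_quantile hy]

theorem quantile_mem_Ioo (hH : HasBoundedDensityOn H h l r) {y : ℝ} (hy : y ∈ Ioo (0 : ℝ) 1) :
    quantile H l r y ∈ Ioo l r := by
  have h1 := hH.quantile_mem (Ioo_subset_Icc_self hy)
  have h2 := hH.apply_quantile (Ioo_subset_Icc_self hy)
  refine ⟨h1.1.lt_of_ne fun h => ?_, h1.2.lt_of_ne fun h => ?_⟩
  · rw [← h, hH.eq_zero_of_le le_rfl] at h2
    exact hy.1.ne h2
  · rw [h, hH.eq_one_of_ge le_rfl] at h2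
    exact hy.2.ne' h2

/-- The lower bound `m` on the density makes the inverse Lipschitz with constant `1/m`. -/
theorem continuousAt_quantile (hH : HasBoundedDensityOn H h l r) {y : ℝ}
    (hy : y ∈ Ioo (0 : ℝ) 1) : ContinuousAt (quantile H l r) y := by
  obtain ⟨m, hm, hb⟩ := hH.exists_mul_sub_le
  have hlip : ∀ u ∈ Icc (0 : ℝ) 1, ∀ v ∈ Icc (0 : ℝ) 1,
      |quantile H l r u - quantile H l r v| ≤ m⁻¹ * |u - v| := by
    intro u hu v hv
    wlog huv : u ≤ v generalizing u v
    · rw [abs_sub_comm, abs_sub_comm u]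
      exact this v hv u hu (le_of_not_ge huv)
    have hle := (hH.quantile_le_quantile_iff hu hv).2 huv
    have := hb _ (hH.quantile_mem hu) _ (hH.quantile_mem hv) hle
    rw [hH.apply_quantile hu, hH.apply_quantile hv] at this
    rw [abs_sub_comm, abs_sub_comm u, abs_of_nonneg (sub_nonneg.2 hle),
      abs_of_nonneg (sub_nonneg.2 huv), inv_mul_eq_div, le_div_iff₀ hm]
    linarith
  have hev : ∀ᶠ u in 𝓝 y, |quantile H l r u - quantile H l r y| ≤ m⁻¹ * |u - y| := by
    filter_upwards [Ioo_mem_nhds hy.1 hy.2] with u hu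
    exact hlip u (Ioo_subset_Icc_self hu) y (Ioo_subset_Icc_self hy)
  have ht : Tendsto (fun u => m⁻¹ * |u - y|) (𝓝 y) (𝓝 0) := by
    have : Continuous fun u => m⁻¹ * |u - y| := by fun_prop
    simpa using this.tendsto y
  exact tendsto_iff_dist_tendsto_zero.2
    (squeeze_zero' (Eventually.of_forall fun _ => dist_nonneg) hev ht)

theorem hasDerivAt_quantile (hH : HasBoundedDensityOn H h l r)
    (hc : ContinuousOn h (Ioo l r)) {y : ℝ} (hy : y ∈ Ioo (0 : ℝ) 1) :
    HasDerivAt (quantile H l r) (h (quantile H l r y))⁻¹ y := by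
  have hmem := hH.quantile_mem_Ioo hy
  refine HasDerivAt.of_local_left_inverse (hH.continuousAt_quantile hy)
    (hH.hasDerivAt (hc.continuousAt (Ioo_mem_nhds hmem.1 hmem.2)))
    (hH.pos_of_mem (Ioo_subset_Icc_self hmem)).ne' ?_
  filter_upwards [Ioo_mem_nhds hy.1 hy.2] with u hu
  exact hH.apply_quantile (Ioo_subset_Icc_self hu)

/-- A measure with distribution function `H` has no atoms. -/
theorem nullSingletonClass (hH : HasBoundedDensityOn H h l r) {ν : Measure ℝ}
    [IsProbabilityMeasure ν] (hν : ∀ x, ν.real (Iic x) = H x) : NullSingletonClass ν := by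
  refine ⟨fun x => ?_⟩
  have hcdf : (cdf ν : ℝ → ℝ) = H := funext fun y => (cdf_eq_real ν y).trans (hν y)
  have h1 : Function.leftLim (cdf ν) x = cdf ν x :=
    ContinuousWithinAt.leftLim_eq (hcdf ▸ hH.continuous.continuousWithinAt)
  rw [← measure_cdf ν, StieltjesFunction.measure_singleton, h1, sub_self, ENNReal.ofReal_zero]

end HasBoundedDensityOn

/-! ### Markets with identical distributions of valuations and costs -/

namespace MarketModel

variable {m : MarketModel}

theorem Regular.support_eq (hm : m.Regular) (hFG : m.F = m.G) : m.a = m.c ∧ m.b = m.d := by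
  have h := hm.buyers
  rw [hFG] at h
  exact h.support_unique hm.sellers

theorem Regular.Ginv_eq (hm : m.Regular) (hFG : m.F = m.G) : m.Ginv = m.Finv := by
  obtain ⟨h1, h2⟩ := hm.support_eq hFG
  rw [Ginv, Finv, hFG, h1, h2]

/-- Where they are continuous, both densities are the derivative of the same function. At the
endpoints of the support they may differ. -/
theorem Regular.density_eq (hm : m.Regular) (hf : ContinuousOn m.f (Ioo m.a m.b))
    (hg : ContinuousOn m.g (Ioo m.c m.d)) (hFG : m.F = m.G) {x : ℝ} (hx : x ∈ Ioo m.a m.b) :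
    m.g x = m.f x := by
  obtain ⟨h1, h2⟩ := hm.support_eq hFG
  have hx' : x ∈ Ioo m.c m.d := h1 ▸ h2 ▸ hx
  have hF := hm.buyers.hasDerivAt (hf.continuousAt (Ioo_mem_nhds hx.1 hx.2))
  have hG := hm.sellers.hasDerivAt (hg.continuousAt (Ioo_mem_nhds hx'.1 hx'.2))
  rw [hFG] at hF
  exact hG.unique hF

/-- Equal supports give `F d = 1` and `G a = 0`, so the admissible ratios fill `[ε, 1/ε]`. -/
theorem Regular.mem_indexSet (hm : m.Regular) (hFG : m.F = m.G) {ε : ℝ} {M N : ℕ}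
    (h : (M, N) ∈ m.indexSet ε) : 0 < M ∧ 0 < N ∧ ε ≤ ratio M N ∧ ratio M N ≤ 1 / ε := by
  obtain ⟨h1, h2⟩ := hm.support_eq hFG
  obtain ⟨hM, hN, h3, h4⟩ := h
  rw [← h2, hm.buyers.eq_one_of_ge le_rfl] at h3
  rw [h1, hm.sellers.eq_zero_of_le le_rfl] at h4
  refine ⟨hM, hN, ?_, ?_⟩
  · simpa using h3
  · simpa using h4

theorem ratio_pos {M N : ℕ} (hM : 0 < M) (hN : 0 < N) : 0 < ratio M N := by
  unfold ratio
  positivity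

variable {lam : ℝ}

theorem one_sub_div_one_add (hl : 0 < lam) : 1 - lam / (1 + lam) = 1 / (1 + lam) := by
  field_simp
  ring

theorem inv_mul_div_one_add (hl : 0 < lam) : lam⁻¹ * (lam / (1 + lam)) = 1 / (1 + lam) := by
  field_simp

theorem one_div_one_add_mem (hl : 0 < lam) : 1 / (1 + lam) ∈ Ioo (0 : ℝ) 1 :=
  ⟨by positivity, by rw [div_lt_one (by positivity)]; linarith⟩

theorem div_one_add_mem (hl : 0 < lam) : lam / (1 + lam) ∈ Ioo (0 : ℝ) 1 :=
  ⟨by positivity, by rw [div_lt_one (by positivity)]; linarith⟩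

theorem Regular.tStar_eq (hm : m.Regular) (hFG : m.F = m.G) (hl : 0 < lam) :
    m.tStar lam = lam / (1 + lam) := by
  have hmem := div_one_add_mem hl
  have hset : {t ∈ Ioo (0 : ℝ) 1 | 0 ≤ m.E lam t} = Ioc 0 (lam / (1 + lam)) := by
    ext t
    have hiff : ∀ t ∈ Ioo (0 : ℝ) 1, (0 ≤ m.E lam t ↔ t ≤ lam / (1 + lam)) := by
      intro t ht
      have h1 : 0 < lam⁻¹ * t := mul_pos (inv_pos.2 hl) ht.1
      -- Quantiles are compared through their arguments, and the cap is harmless: `1 ≤ 1 - t` fails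
      -- for `t > 0`.
      rw [E, hm.Ginv_eq hFG, capped, sub_nonneg, Finv, hm.buyers.quantile_le_quantile_iff
        ⟨le_min h1.le zero_le_one, min_le_right _ _⟩ ⟨by linarith [ht.2], by linarith [ht.1]⟩,
        min_le_iff, or_iff_left (by linarith [ht.1]), inv_mul_eq_div, div_le_iff₀ hl,
        le_div_iff₀ (by positivity)]
      constructor <;> intro h <;> linarith
    constructor
    · rintro ⟨ht, h⟩
      exact ⟨ht.1, (hiff t ht).1 h⟩
    · rintro ⟨h0, h⟩
      have ht : t ∈ Ioo (0 : ℝ) 1 := ⟨h0, h.trans_lt hmem.2⟩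
      exact ⟨ht, (hiff t ht).2 h⟩
  rw [tStar, lastNonneg, hset, csSup_Ioc hmem.1]

/-- Both quantiles are differentiated at the same point `1/(1 + λ)`, and near `t_α` the cap is
inactive. -/
theorem Regular.deriv_E (hm : m.Regular) (hf : ContinuousOn m.f (Ioo m.a m.b))
    (hFG : m.F = m.G) (hl : 0 < lam) :
    deriv (m.E lam) (lam / (1 + lam)) =
      -((1 + lam) / (lam * m.f (m.Finv (1 / (1 + lam))))) := by
  have hq := hm.buyers.hasDerivAt_quantile hf (one_div_one_add_mem hl)
  have hpos : 0 < m.f (m.Finv (1 / (1 + lam))) := hm.buyers.pos_of_mem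
    (Ioo_subset_Icc_self (hm.buyers.quantile_mem_Ioo (one_div_one_add_mem hl)))
  have h1 : HasDerivAt (fun t : ℝ => m.Finv (1 - t))
      ((m.f (m.Finv (1 / (1 + lam))))⁻¹ * (-1)) (lam / (1 + lam)) := by
    refine HasDerivAt.comp (h₂ := m.Finv) (lam / (1 + lam)) ?_ ((hasDerivAt_id _).const_sub 1)
    rw [one_sub_div_one_add hl]
    exact hq
  have h2 : HasDerivAt (fun t : ℝ => m.Finv (lam⁻¹ * t))
      ((m.f (m.Finv (1 / (1 + lam))))⁻¹ * (lam⁻¹ * 1)) (lam / (1 + lam)) := by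
    refine HasDerivAt.comp (h₂ := m.Finv) (lam / (1 + lam)) ?_ ((hasDerivAt_id _).const_mul lam⁻¹)
    rw [inv_mul_div_one_add hl]
    exact hq
  have hev : m.E lam =ᶠ[𝓝 (lam / (1 + lam))] fun t => m.Finv (1 - t) - m.Finv (lam⁻¹ * t) := by
    have hc : ContinuousAt (fun t : ℝ => lam⁻¹ * t) (lam / (1 + lam)) := by fun_prop
    have hlt : lam⁻¹ * (lam / (1 + lam)) < 1 := by
      rw [inv_mul_div_one_add hl]
      exact (one_div_one_add_mem hl).2
    filter_upwards [hc.eventually_lt_const hlt] with t ht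
    rw [E, hm.Ginv_eq hFG, capped, min_eq_left ht.le]
  rw [(HasDerivAt.congr_of_eventuallyEq (h1.sub h2) hev).deriv]
  field_simp
  ring

theorem Regular.sigmaSq_eq (hm : m.Regular) (hf : ContinuousOn m.f (Ioo m.a m.b))
    (hg : ContinuousOn m.g (Ioo m.c m.d)) (hFG : m.F = m.G) (hl : 0 < lam) :
    m.sigmaSq lam = lam ^ 2 / (1 + lam) ^ 3 := by
  have hx : m.Finv (1 / (1 + lam)) ∈ Ioo m.a m.b :=
    hm.buyers.quantile_mem_Ioo (one_div_one_add_mem hl)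
  have hpos : 0 < m.f (m.Finv (1 / (1 + lam))) := hm.buyers.pos_of_mem (Ioo_subset_Icc_self hx)
  rw [sigmaSq, hm.tStar_eq hFG hl, hm.deriv_E hf hFG hl, hm.Ginv_eq hFG, one_sub_div_one_add hl,
    inv_mul_div_one_add hl, hm.density_eq hf hg hFG hx]
  field_simp
  ring

/-! ### The uniform market -/

section uniform

/-- By continuity `F t = t` on `[0, 1]`. Since `F > 0` right of `a` and `F < 1` left of `b`, the
support lies in `[0, 1]`, so `a = F a = 0` and `b = F b = 1`. -/
theorem Regular.uniform_support (hm : m.Regular)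
    (hU : ∀ t ∈ Ioo (0 : ℝ) 1, m.F t = t) : m.a = 0 ∧ m.b = 1 := by
  have hB := hm.buyers
  have hab := hB.lt
  have hcl : ∀ t ∈ Icc (0 : ℝ) 1, m.F t = t := by
    intro t ht
    have hclosed : IsClosed {t | m.F t = t} := isClosed_eq hB.continuous continuous_id
    have : closure (Ioo (0 : ℝ) 1) ⊆ {t | m.F t = t} := hclosed.closure_subset_iff.2 hU
    rw [closure_Ioo zero_ne_one] at this
    exact this ht
  have h0 := hcl 0 ⟨le_rfl, zero_le_one⟩
  have h1 := hcl 1 ⟨zero_le_one, le_rfl⟩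
  have ha : 0 ≤ m.a := le_of_not_gt fun h => (hB.apply_pos h).ne' h0
  have hb : m.b ≤ 1 := le_of_not_gt fun h => (hB.apply_lt_one h).ne h1
  have ha' : m.F m.a = m.a := hcl _ ⟨ha, hab.le.trans hb⟩
  have hb' : m.F m.b = m.b := hcl _ ⟨ha.trans hab.le, hb⟩
  rw [hB.eq_zero_of_le le_rfl] at ha'
  rw [hB.eq_one_of_ge le_rfl] at hb'
  exact ⟨ha'.symm, hb'.symm⟩

theorem Regular.uniform_apply (hm : m.Regular)
    (hU : ∀ t ∈ Ioo (0 : ℝ) 1, m.F t = t) {t : ℝ} (ht : t ∈ Icc (0 : ℝ) 1) : m.F t = t := by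
  obtain ⟨ha, hb⟩ := hm.uniform_support hU
  rcases ht.1.eq_or_lt with rfl | h0
  · exact hm.buyers.eq_zero_of_le ha.ge
  rcases ht.2.eq_or_lt with rfl | h1
  · exact hm.buyers.eq_one_of_ge hb.le
  exact hU t ⟨h0, h1⟩

theorem Regular.uniform_Finv (hm : m.Regular)
    (hU : ∀ t ∈ Ioo (0 : ℝ) 1, m.F t = t) {t : ℝ} (ht : t ∈ Icc (0 : ℝ) 1) : m.Finv t = t := by
  obtain ⟨ha, hb⟩ := hm.uniform_support hU
  exact hm.buyers.quantile_eq (ha.symm ▸ hb.symm ▸ ht) (hm.uniform_apply hU ht)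

theorem Regular.uniform_density (hm : m.Regular) (hf : ContinuousOn m.f (Ioo m.a m.b))
    (hU : ∀ t ∈ Ioo (0 : ℝ) 1, m.F t = t) {t : ℝ} (ht : t ∈ Ioo (0 : ℝ) 1) : m.f t = 1 := by
  obtain ⟨ha, hb⟩ := hm.uniform_support hU
  have ht' : t ∈ Ioo m.a m.b := ha.symm ▸ hb.symm ▸ ht
  have h1 := hm.buyers.hasDerivAt (hf.continuousAt (Ioo_mem_nhds ht'.1 ht'.2))
  have h2 : HasDerivAt m.F 1 t := by
    refine (hasDerivAt_id t).congr_of_eventuallyEq ?_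
    filter_upwards [Ioo_mem_nhds ht.1 ht.2] with u hu
    exact hU u hu
  exact h1.unique h2

variable (hm : m.Regular) (hf : ContinuousOn m.f (Ioo m.a m.b))
  (hg : ContinuousOn m.g (Ioo m.c m.d)) (hFG : m.F = m.G)
  (hU : ∀ t ∈ Ioo (0 : ℝ) 1, m.F t = t)
include hm hFG hU

theorem Regular.uniform_integral_E (hl : 0 < lam) :
    ∫ t in (0 : ℝ)..(lam / (1 + lam)), m.E lam t = lam / (2 * (1 + lam)) := by
  have hmem := div_one_add_mem hl
  have hcongr : ∫ t in (0 : ℝ)..(lam / (1 + lam)), m.E lam t =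
      ∫ t in (0 : ℝ)..(lam / (1 + lam)), (1 - (1 + lam⁻¹) * t) := by
    refine intervalIntegral.integral_congr fun t ht => ?_
    rw [uIcc_of_le hmem.1.le] at ht
    have h1 : 0 ≤ lam⁻¹ * t := mul_nonneg (inv_pos.2 hl).le ht.1
    have h2 : lam⁻¹ * t ≤ 1 := by
      calc lam⁻¹ * t ≤ lam⁻¹ * (lam / (1 + lam)) :=
            mul_le_mul_of_nonneg_left ht.2 (inv_pos.2 hl).le
        _ ≤ 1 := by rw [inv_mul_div_one_add hl]; exact (one_div_one_add_mem hl).2.le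
    change m.E lam t = _
    rw [E, hm.Ginv_eq hFG, capped, min_eq_left h2, hm.uniform_Finv hU ⟨h1, h2⟩,
      hm.uniform_Finv hU ⟨by linarith [ht.2, hmem.2], by linarith [ht.1]⟩]
    ring
  rw [hcongr, intervalIntegral.integral_sub (by simp) (Continuous.intervalIntegrable (by fun_prop) _ _),
    intervalIntegral.integral_const_mul, integral_id, intervalIntegral.integral_const, smul_eq_mul]
  field_simp
  ring

include hf hg

/-- The point `t = 0` is excluded because the densities are not determined at the endpoints of the
support; the integral of `S` does not see it. -/
theorem Regular.uniform_S (hl : 0 < lam) {t : ℝ} (ht : t ∈ Ioc 0 (lam / (1 + lam))) :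
    m.S lam t = (1 - t) * (t ^ 2 / 2) + (1 - lam⁻¹ * t) * ((lam⁻¹ * t) ^ 2 / 2) := by
  obtain ⟨ha, hb⟩ := hm.uniform_support hU
  obtain ⟨hac, hbd⟩ := hm.support_eq hFG
  have hmem := div_one_add_mem hl
  have h1 : 0 < lam⁻¹ * t := mul_pos (inv_pos.2 hl) ht.1
  have h2 : lam⁻¹ * t < 1 := by
    calc lam⁻¹ * t ≤ lam⁻¹ * (lam / (1 + lam)) :=
          mul_le_mul_of_nonneg_left ht.2 (inv_pos.2 hl).le
      _ < 1 := by rw [inv_mul_div_one_add hl]; exact (one_div_one_add_mem hl).2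
  have hu : 1 - t ∈ Ioo (0 : ℝ) 1 := ⟨by linarith [ht.2, hmem.2], by linarith [ht.1]⟩
  have hI1 : ∫ x in (1 - t)..m.b, (1 - m.F x) = t ^ 2 / 2 := by
    rw [hb, intervalIntegral.integral_congr (g := fun x => 1 - x) fun x hx => by
      rw [uIcc_of_le hu.2.le] at hx
      change 1 - m.F x = 1 - x
      rw [hm.uniform_apply hU ⟨hu.1.le.trans hx.1, hx.2⟩],
      intervalIntegral.integral_sub (by simp) (Continuous.intervalIntegrable (by fun_prop) _ _),
      integral_id, intervalIntegral.integral_const, smul_eq_mul]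
    ring
  have hI2 : ∫ x in m.c..(lam⁻¹ * t), m.G x = (lam⁻¹ * t) ^ 2 / 2 := by
    rw [← hac, ha, ← hFG, intervalIntegral.integral_congr (g := fun x => x) fun x hx => by
      rw [uIcc_of_le h1.le] at hx
      exact hm.uniform_apply hU ⟨hx.1, hx.2.trans h2.le⟩, integral_id]
    ring
  have hg1 : m.g (lam⁻¹ * t) = 1 := by
    rw [hm.density_eq hf hg hFG (ha.symm ▸ hb.symm ▸ ⟨h1, h2⟩), hm.uniform_density hf hU ⟨h1, h2⟩]
  rw [S, hm.Ginv_eq hFG, hm.uniform_Finv hU (Ioo_subset_Icc_self hu),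
    hm.uniform_Finv hU ⟨h1.le, h2.le⟩, hI1, hI2, hg1, hm.uniform_density hf hU hu, div_one, div_one]

theorem Regular.uniform_varsigmaSq (hl : 0 < lam) :
    m.varsigmaSq lam = lam * (1 + 3 * lam + lam ^ 2) / (12 * (1 + lam) ^ 3) := by
  have hmem := div_one_add_mem hl
  have hcongr : ∫ t in (0 : ℝ)..(lam / (1 + lam)), m.S lam t =
      ∫ t in (0 : ℝ)..(lam / (1 + lam)),
        ((1 + (lam⁻¹) ^ 2) / 2 * t ^ 2 - (1 + (lam⁻¹) ^ 3) / 2 * t ^ 3) := by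
    refine intervalIntegral.integral_congr_ae (Eventually.of_forall fun t ht => ?_)
    rw [uIoc_of_le hmem.1.le] at ht
    rw [hm.uniform_S hf hg hFG hU hl ht]
    ring
  rw [varsigmaSq, hm.tStar_eq hFG hl, hcongr,
    intervalIntegral.integral_sub (Continuous.intervalIntegrable (by fun_prop) _ _)
      (Continuous.intervalIntegrable (by fun_prop) _ _),
    intervalIntegral.integral_const_mul, intervalIntegral.integral_const_mul, integral_pow,
    integral_pow]
  push_cast
  field_simp
  ring

theorem Regular.uniform_kappa (hl : 0 < lam) :
    m.kappa lam = lam ^ 2 / (2 * (1 + lam) ^ 3) := by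
  have hmem := div_one_add_mem hl
  have hu := one_div_one_add_mem hl
  rw [kappa, hm.tStar_eq hFG hl, hm.deriv_E hf hFG hl, hm.uniform_S hf hg hFG hU hl ⟨hmem.1, le_rfl⟩,
    inv_mul_div_one_add hl, hm.uniform_Finv hU (Ioo_subset_Icc_self hu),
    hm.uniform_density hf hU hu]
  field_simp
  ring

end uniform

/-! ### The efficient quantity of a market with identical distributions -/

/-- A law on the line is determined by its distribution function; the law of the first valuation,
available as `N > 0`, serves as `ν`. -/
theorem IsRealization.exists_law (hm : m.Regular) (hFG : m.F = m.G) {Ω : Type*}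
    [MeasurableSpace Ω] {P : Measure Ω} [IsProbabilityMeasure P] {M N : ℕ} (hN : 0 < N)
    {V : Fin N → Ω → ℝ} {C : Fin M → Ω → ℝ} (hR : m.IsRealization P V C) :
    ∃ ν : Measure ℝ, NullSingletonClass ν ∧ ∀ i, P.map (Sum.elim V C i) = ν := by
  have hX : ∀ i, Measurable (Sum.elim V C i) := by
    rintro (i | j)
    exacts [hR.measurable_V i, hR.measurable_C j]
  have hreal : ∀ i x, (P.map (Sum.elim V C i)).real (Iic x) = m.F x := by
    intro i x
    rw [map_measureReal_apply (hX i) measurableSet_Iic]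
    rcases i with i | j
    · exact hR.law_V i x
    · rw [hFG]
      exact hR.law_C j x
  have hprob : ∀ i, IsProbabilityMeasure (P.map (Sum.elim V C i)) := fun i =>
    Measure.isProbabilityMeasure_map (hX i).aemeasurable
  refine ⟨P.map (Sum.elim V C (Sum.inl ⟨0, hN⟩)), hm.buyers.nullSingletonClass (hreal _), ?_⟩
  intro i
  refine Measure.ext_of_Iic _ _ fun x => ?_
  rw [← measureReal_eq_measureReal_iff, hreal, hreal]

theorem IsRealization.measureReal_efficientQuantity (hm : m.Regular) (hFG : m.F = m.G)
    {Ω : Type*} [MeasurableSpace Ω] {P : Measure Ω} [IsProbabilityMeasure P] {M N : ℕ}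
    (hN : 0 < N) {V : Fin N → Ω → ℝ} {C : Fin M → Ω → ℝ} (hR : m.IsRealization P V C)
    (Q : ℕ → Prop) [DecidablePred Q] :
    P.real {ω | Q (efficientQuantity (fun i => V i ω) (fun j => C j ω))} =
      hyperMean M N fun k => if Q k then 1 else 0 := by
  obtain ⟨ν, hν, hlaw⟩ := hR.exists_law hm hFG hN
  refine measureReal_efficientQuantity_eq_hyperMean hN ?_ hR.indep hlaw Q
  rintro (i | j)
  exacts [hR.measurable_V i, hR.measurable_C j]

end MarketModel

/-! ### The Kolmogorov distance to the normal distribution -/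

section kolmogorov

variable {Ω : Type*} [MeasurableSpace Ω] {P : Measure Ω} [IsProbabilityMeasure P] {X : Ω → ℝ}

theorem abs_sub_stdCDF_le_kolmogorovDistNormal (x : ℝ) :
    |P.real {ω | X ω ≤ x} - stdCDF x| ≤ kolmogorovDistNormal P X := by
  -- The bound 1 is needed: an unbounded real supremum would take the default value 0.
  refine le_ciSup (f := fun x => |P.real {ω | X ω ≤ x} - stdCDF x|) ⟨1, ?_⟩ x
  rintro _ ⟨y, rfl⟩
  have h1 : P.real {ω | X ω ≤ y} ≤ 1 := measureReal_le_one
  have h2 : 0 ≤ P.real {ω | X ω ≤ y} := measureReal_nonneg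
  exact abs_le.2 ⟨by linarith [stdCDF_le_one y], by linarith [stdCDF_nonneg y]⟩

/-- A jump of the distribution function is at most twice the Kolmogorov distance to the normal
distribution. -/
theorem le_two_mul_kolmogorovDistNormal {p x : ℝ}
    (h : ∀ y < x, p ≤ P.real {ω | X ω ≤ x} - P.real {ω | X ω ≤ y}) :
    p ≤ 2 * kolmogorovDistNormal P X := by
  -- As `y` increases to `x`, the increment of `Φ` vanishes and only the two approximation errors
  -- remain.
  have ht : Tendsto (fun y => 2 * kolmogorovDistNormal P X + (stdCDF x - stdCDF y)) (𝓝[<] x)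
      (𝓝 (2 * kolmogorovDistNormal P X + (stdCDF x - stdCDF x))) :=
    ((continuous_stdCDF.tendsto x).mono_left nhdsWithin_le_nhds |>.const_sub _).const_add _
  rw [sub_self, add_zero] at ht
  refine ge_of_tendsto ht ?_
  filter_upwards [self_mem_nhdsWithin] with y hy
  have h1 := abs_le.1 (abs_sub_stdCDF_le_kolmogorovDistNormal (P := P) (X := X) x)
  have h2 := abs_le.1 (abs_sub_stdCDF_le_kolmogorovDistNormal (P := P) (X := X) y)
  linarith [h y hy, h1.2, h2.1]

end kolmogorov

theorem mul_div_one_add_ratio {M N : ℕ} (hM : 0 < M) (hN : 0 < N) :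
    (N : ℝ) * (ratio M N / (1 + ratio M N)) = hyperCenter M N := by
  unfold ratio hyperCenter
  field_simp
  ring

theorem kolmogorov_bounds_of_isRealization {m : MarketModel} (hm : m.Regular)
    (hf : ContinuousOn m.f (Ioo m.a m.b)) (hg : ContinuousOn m.g (Ioo m.c m.d))
    {ε : ℝ} (hε : 0 < ε) (hFG : m.F = m.G) {M N : ℕ} (hα : (M, N) ∈ m.indexSet ε)
    {Ω : Type*} [MeasurableSpace Ω] {P : Measure Ω} [IsProbabilityMeasure P]
    {V : Fin N → Ω → ℝ} {C : Fin M → Ω → ℝ} (hR : m.IsRealization P V C) :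
    3 / 40 / √N ≤ kolmogorovDistNormal P (fun ω =>
        ((efficientQuantity (fun i => V i ω) (fun j => C j ω) : ℝ) - N * m.tStar (ratio M N)) /
          (√(m.sigmaSq (ratio M N)) * √N)) ∧
      kolmogorovDistNormal P (fun ω =>
        ((efficientQuantity (fun i => V i ω) (fun j => C j ω) : ℝ) - N * m.tStar (ratio M N)) /
          (√(m.sigmaSq (ratio M N)) * √N)) ≤ 100 / ε ^ 4 / √N := by
  obtain ⟨hM, hN, hlo, hhi⟩ := hm.mem_indexSet hFG hα
  have hl : 0 < ratio M N := MarketModel.ratio_pos hM hN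
  have hM' : (0 : ℝ) < M := by positivity
  have hN' : (0 : ℝ) < N := by positivity
  rw [hm.tStar_eq hFG hl, hm.sigmaSq_eq hf hg hFG hl, mul_div_one_add_ratio hM hN]
  set s := √(ratio M N ^ 2 / (1 + ratio M N) ^ 3) * √N with hs
  have hs0 : 0 < s := by positivity
  have hs2 : s ^ 2 = (M : ℝ) ^ 2 * N ^ 2 / (M + N) ^ 3 := by
    rw [hs, mul_pow, Real.sq_sqrt (by positivity), Real.sq_sqrt hN'.le]
    unfold ratio
    field_simp
    ring
  have hcdf : ∀ x, P.real {ω | ((efficientQuantity (fun i => V i ω) (fun j => C j ω) : ℝ) -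
      hyperCenter M N) / s ≤ x} =
        hyperMean M N fun k => if ((k : ℝ) - hyperCenter M N) / s ≤ x then 1 else 0 := fun x =>
    hR.measureReal_efficientQuantity hm hFG hN fun k => ((k : ℝ) - hyperCenter M N) / s ≤ x
  constructor
  · obtain ⟨j, hjN, hj⟩ := exists_le_hypergeometricProb hM hN
    have h1 : hypergeometricProb N M (N + M) j ≤ 2 * kolmogorovDistNormal P (fun ω =>
        ((efficientQuantity (fun i => V i ω) (fun j => C j ω) : ℝ) - hyperCenter M N) / s) := by
      -- The atom at `j` is a jump of the standardized distribution function at `(j - c)/s`.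
      refine le_two_mul_kolmogorovDistNormal (x := ((j : ℝ) - hyperCenter M N) / s) fun y hy => ?_
      rw [hcdf, hcdf, ← hyperMean_sub]
      have h2 := hyperMean_ite_eq_mul (M := M) hjN fun _ => (1 : ℝ)
      rw [one_mul] at h2
      rw [← h2]
      refine hyperMean_mono fun k _ _ => ?_
      by_cases hk : k = j
      · subst hk
        rw [if_pos rfl, if_pos le_rfl, if_neg hy.not_ge]
        norm_num
      · rw [if_neg hk, mul_zero]
        split_ifs with h3 h4
        · norm_num
        · norm_num
        · exact absurd (by linarith) h3
        · norm_num
    have h5 : 3 / 20 / √(N : ℝ) = 2 * (3 / 40 / √(N : ℝ)) := by ring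
    linarith
  · refine ciSup_le fun x => ?_
    rw [hcdf]
    -- The existence of an admissible ratio forces `ε ≤ 1/ε`.
    have hε1 : ε ≤ 1 := by
      have := hlo.trans hhi
      rw [le_div_iff₀ hε] at this
      nlinarith
    have e1 : ε * N ≤ M := by
      rwa [ratio, le_div_iff₀ hN'] at hlo
    have e2 : ε * M ≤ N := by
      rw [ratio, div_le_div_iff₀ hN' hε] at hhi
      linarith
    exact abs_hyperMean_sub_stdCDF_le hε hε1 hM hN e1 e2 hs0 hs2 x

theorem theorem2 (m : MarketModel) (hm : m.Regular)
    (hf : ContinuousOn m.f (Ioo m.a m.b)) (hg : ContinuousOn m.g (Ioo m.c m.d))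
    (ε : ℝ) (hε : 0 < ε) (hFG : m.F = m.G) :
    (∀ M N : ℕ, (M, N) ∈ m.indexSet ε →
      m.tStar (ratio M N) = ratio M N / (1 + ratio M N) ∧
      m.sigmaSq (ratio M N) = ratio M N ^ 2 / (1 + ratio M N) ^ 3) ∧
    (∀ M N : ℕ, (M, N) ∈ m.indexSet ε →
      ∀ (Ω : Type*) [MeasurableSpace Ω] (P : Measure Ω) [IsProbabilityMeasure P]
        (V : Fin N → Ω → ℝ) (C : Fin M → Ω → ℝ), m.IsRealization P V C →
        ∀ k : ℕ, P.real {ω | efficientQuantity (fun i => V i ω) (fun j => C j ω) = k} =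
          hypergeometricProb N M (N + M) k) ∧
    (∃ C₁ C₂ : ℝ, 0 < C₁ ∧ 0 < C₂ ∧
      ∀ M N : ℕ, (M, N) ∈ m.indexSet ε →
      ∀ (Ω : Type*) [MeasurableSpace Ω] (P : Measure Ω) [IsProbabilityMeasure P]
        (V : Fin N → Ω → ℝ) (C : Fin M → Ω → ℝ), m.IsRealization P V C →
        C₁ / Real.sqrt N ≤
          kolmogorovDistNormal P (fun ω =>
            ((efficientQuantity (fun i => V i ω) (fun j => C j ω) : ℝ)
              - N * m.tStar (ratio M N)) /
              (Real.sqrt (m.sigmaSq (ratio M N)) * Real.sqrt N)) ∧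
        kolmogorovDistNormal P (fun ω =>
            ((efficientQuantity (fun i => V i ω) (fun j => C j ω) : ℝ)
              - N * m.tStar (ratio M N)) /
              (Real.sqrt (m.sigmaSq (ratio M N)) * Real.sqrt N)) ≤
          C₂ / Real.sqrt N) ∧
    ((∀ t ∈ Ioo (0 : ℝ) 1, m.F t = t ∧ m.G t = t) →
      ∀ M N : ℕ, (M, N) ∈ m.indexSet ε →
        ∫ t in (0 : ℝ)..(m.tStar (ratio M N)), m.E (ratio M N) t =
          ratio M N / (2 * (1 + ratio M N)) ∧
        m.varsigmaSq (ratio M N) =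
          ratio M N * (1 + 3 * ratio M N + ratio M N ^ 2) / (12 * (1 + ratio M N) ^ 3) ∧
        m.kappa (ratio M N) = ratio M N ^ 2 / (2 * (1 + ratio M N) ^ 3)) := by
  refine ⟨fun M N hα => ?_, fun M N hα Ω _ P _ V C hR k => ?_,
    ⟨3 / 40, 100 / ε ^ 4, by norm_num, by positivity, fun M N hα Ω _ P _ V C hR =>
      kolmogorov_bounds_of_isRealization hm hf hg hε hFG hα hR⟩, fun hU M N hα => ?_⟩
  · obtain ⟨hM, hN, -⟩ := hm.mem_indexSet hFG hα
    exact ⟨hm.tStar_eq hFG (MarketModel.ratio_pos hM hN),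
      hm.sigmaSq_eq hf hg hFG (MarketModel.ratio_pos hM hN)⟩
  · obtain ⟨-, hN, -⟩ := hm.mem_indexSet hFG hα
    rw [hR.measureReal_efficientQuantity hm hFG hN fun j => j = k]
    rcases le_or_gt k N with hk | hk
    · simpa using hyperMean_ite_eq_mul (M := M) hk fun _ => (1 : ℝ)
    · rw [hypergeometricProb, if_neg hk.not_ge]
      refine Finset.sum_eq_zero fun j hj => ?_
      have := Finset.mem_range.1 hj
      have hjk : j ≠ k := by omega
      simp [hjk]
  · obtain ⟨hM, hN, -⟩ := hm.mem_indexSet hFG hα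
    have hl := MarketModel.ratio_pos hM hN
    have hU' : ∀ t ∈ Ioo (0 : ℝ) 1, m.F t = t := fun t ht => (hU t ht).1
    rw [hm.tStar_eq hFG hl]
    exact ⟨hm.uniform_integral_E hFG hU' hl, hm.uniform_varsigmaSq hf hg hFG hU' hl,
      hm.uniform_kappa hf hg hFG hU' hl⟩
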